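/- Let $M=\mathbb{C}\mathrm{H}^k$, $k\ge 1$, be the complex hyperbolic space, with complex structure $J$ and with the metric normalized to have holomorphic sectional curvature $-4$ (so the sectional curvatures lie in $[-4,-1]$ if $k\ge 2$, and $M$ is the hyperbolic plane of curvature $-4$ if $k=1$). Let $\mathcal R$ be the curvature tensor of $M$, with the sign for which $\langle \mathcal R(x,y)y,x\rangle$ is the sectional curvature of an orthonormal pair $x,y$. A complex hyperbolic plane in $M$ is a totally geodesic surface $\exp_b(\mathrm{span}_{\mathbb R}(u,v))$, where $b\in M$, $u,v\in T_bM$ are orthonormal and $\mathcal R(v,u)u=-4v$. Let $E\subset M$ be a complex hyperbolic plane and let $E^\perp$ be its normal bundle; write $E^\perp_aM=(T_aE)^\perp\subset T_aM$ for its fiber at $a\in E$ and $U_aE^\perp$ for the unit sphere of $E^\perp_aM$. The sphere $U_aE^\perp$ is fibered by the circles $T_aL\cap U_aE^\perp$, where $L$ runs over the complex hyperbolic planes through $a$ that are contained in the orthogonal complement $\exp_a(E^\perp_aM)$ to $E$ at $a$. The holonomy of $E^\perp$ along a loop in $E$ is the parallel translation of normal vectors along this loop with respect to the Levi-Civita connection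 of $M$. Then: 1. For every $a\in E$ and every piecewise smooth loop in $E$ with vertex $a$, the holonomy along the loop is a well-defined map $E^\perp_aM\to E^\perp_aM$, and it maps every circle $T_aL\cap U_aE^\perp$ of the above fibration onto itself. 2. If $k\ge 2$, then $E^\perp$ is not flat: it is not true that every point $a\in E$ has a neighbourhood in $E$ such that the holonomy of $E^\perp$ along every piecewise smooth loop in this neighbourhood with vertex $a$ is the identity. 3. For every $a\in E$, every unit vector $x\in T_aE$ and every $z\in U_aE^\perp$, one has $\mathcal R(x,Jx)z=2Jz$. -/

import Mathlib

open Set Filter Topology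
open scoped ContDiff

/-! ## Riemannian geometry in a global chart

A Riemannian metric on an open subset of a real normed space `V` is given by its value
`g p : V →L[ℝ] V →L[ℝ] ℝ` at every point `p`; all tangent spaces are identified with `V`. -/

namespace ChartGeometry

variable {V : Type*} [NormedAddCommGroup V] [NormedSpace ℝ V]

/-- The right-hand side of the Koszul formula for constant vector fields `u`, `v`, `w`, as a
linear form in `w`: half of `D_u g(v, w) + D_v g(u, w) - D_w g(u, v)` at `p`. -/
noncomputable def koszulForm (g : V → V →L[ℝ] V →L[ℝ] ℝ) (p u v : V) : V →L[ℝ] ℝ :=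
  (1 / 2 : ℝ) •
    (fderiv ℝ g p u v + fderiv ℝ g p v u - ((fderiv ℝ g p).flip u).flip v)

/-- The Christoffel map `Γ_p(u, v)` of the Levi-Civita connection of `g`: the vector that
represents the Koszul form with respect to `g p` (see `metric_christoffel`). -/
noncomputable def christoffel (g : V → V →L[ℝ] V →L[ℝ] ℝ) (p u v : V) : V :=
  (g p).inverse (koszulForm g p u v)

theorem metric_christoffel (g : V → V →L[ℝ] V →L[ℝ] ℝ) (p : V) (hp : (g p).IsInvertible)
    (u v w : V) :
    g p (christoffel g p u v) w =
      (1 / 2 : ℝ) * (fderiv ℝ g p u v w + fderiv ℝ g p v u w - fderiv ℝ g p w u v) := by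
  obtain ⟨e, he⟩ := hp
  have h : g p (christoffel g p u v) = koszulForm g p u v := by
    rw [christoffel, ← he]
    simp
  rw [h]
  simp [koszulForm]

/-- The Levi-Civita covariant derivative `∇_X Y` of vector fields. -/
noncomputable def cov (g : V → V →L[ℝ] V →L[ℝ] ℝ) (X Y : V → V) (p : V) : V :=
  fderiv ℝ Y p (X p) + christoffel g p (X p) (Y p)

/-- The curvature tensor `R(x, y)z = ∇_X ∇_Y Z - ∇_Y ∇_X Z - ∇_[X,Y] Z` at `p`, computed with the
constant extensions of `x`, `y`, `z` (for which `[X, Y] = 0`). With this sign the sectional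
curvature of an orthonormal pair is `⟨R(x, y)y, x⟩`. -/
noncomputable def curvature (g : V → V →L[ℝ] V →L[ℝ] ℝ) (p x y z : V) : V :=
  cov g (fun _ => x) (cov g (fun _ => y) (fun _ => z)) p
    - cov g (fun _ => y) (cov g (fun _ => x) (fun _ => z)) p

/-- The covariant derivative of a vector field `W` along the curve `c`. -/
noncomputable def covAlong (g : V → V →L[ℝ] V →L[ℝ] ℝ) (c W : ℝ → V) (t : ℝ) : V :=
  deriv W t + christoffel g (c t) (deriv c t) (W t)

/-- Complete geodesics of the metric `g` on `U`. -/
def IsGeodesic (U : Set V) (g : V → V →L[ℝ] V →L[ℝ] ℝ) (c : ℝ → V) : Prop :=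
  ContDiff ℝ ∞ c ∧ ∀ t, c t ∈ U ∧ covAlong g c (deriv c) t = 0

/-- The image `exp_a(S)` of a set `S` of tangent vectors at `a` under the exponential map. -/
def expImage (U : Set V) (g : V → V →L[ℝ] V →L[ℝ] ℝ) (a : V) (S : Set V) : Set V :=
  {q | ∃ c : ℝ → V, IsGeodesic U g c ∧ c 0 = a ∧ deriv c 0 ∈ S ∧ c 1 = q}

/-- The tangent space at `a` of a subset `E` (a submanifold in the applications): velocities at `a`
of smooth curves in `E`. -/
def tangentDirs (E : Set V) (a : V) : Set V :=
  {x | ∃ c : ℝ → V, ContDiffAt ℝ ∞ c 0 ∧ (∀ᶠ t in 𝓝 0, c t ∈ E) ∧ c 0 = a ∧ deriv c 0 = x}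

/-- The fiber at `a` of the normal bundle of `E`. -/
def normalSpace (g : V → V →L[ℝ] V →L[ℝ] ℝ) (E : Set V) (a : V) : Set V :=
  {z | ∀ x ∈ tangentDirs E a, g a x z = 0}

/-- The unit sphere in the fiber at `a` of the normal bundle of `E`. -/
def unitNormalSphere (g : V → V →L[ℝ] V →L[ℝ] ℝ) (E : Set V) (a : V) : Set V :=
  {z ∈ normalSpace g E a | g a z z = 1}

/-- `c`, restricted to `[0, 1]`, is a piecewise smooth loop in `E` with vertex `a`. -/
def IsPiecewiseSmoothLoop (E : Set V) (a : V) (c : ℝ → V) : Prop :=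
  ContinuousOn c (Icc 0 1) ∧ (∀ t ∈ Icc (0 : ℝ) 1, c t ∈ E) ∧ c 0 = a ∧ c 1 = a ∧
    ∃ (n : ℕ) (τ : ℕ → ℝ), Monotone τ ∧ τ 0 = 0 ∧ τ n = 1 ∧
      ∀ i < n, ContDiffOn ℝ ∞ c (Icc (τ i) (τ (i + 1)))

/-- `W` is a parallel vector field along the piecewise smooth curve `c` on `[0, 1]`: it is
continuous, and its covariant derivative vanishes except possibly at finitely many times. -/
def IsParallelAlong (g : V → V →L[ℝ] V →L[ℝ] ℝ) (c W : ℝ → V) : Prop :=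
  ContinuousOn W (Icc 0 1) ∧
    ∃ S : Finset ℝ, ∀ t ∈ Ioo (0 : ℝ) 1, t ∉ S → DifferentiableAt ℝ W t ∧ covAlong g c W t = 0

/-- `w` is the parallel translate of `v` along `c : [0, 1] → V`. -/
def ParallelTranslate (g : V → V →L[ℝ] V →L[ℝ] ℝ) (c : ℝ → V) (v w : V) : Prop :=
  ∃ W : ℝ → V, IsParallelAlong g c W ∧ W 0 = v ∧ W 1 = w

/-- The normal bundle of `E`, with the parallel translation of the ambient Levi-Civita connection,
is flat: its local holonomy is trivial, that is, every point of `E` has a neighbourhood in which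
parallel translation along every loop at that point is the identity on normal vectors. -/
def IsFlatNormalBundle (g : V → V →L[ℝ] V →L[ℝ] ℝ) (E : Set V) : Prop :=
  ∀ a ∈ E, ∃ N ∈ 𝓝 a, ∀ c : ℝ → V, IsPiecewiseSmoothLoop (E ∩ N) a c →
    ∀ z ∈ normalSpace g E a, ParallelTranslate g c z z

end ChartGeometry

/-! ## The complex hyperbolic space in the ball model -/

namespace ComplexHyperbolic

open ChartGeometry

/-- The underlying set of the ball model: the open unit ball of `ℂ^k`. -/
def ball (k : ℕ) : Set (EuclideanSpace ℂ (Fin k)) := Metric.ball 0 1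

/-- The complex hyperbolic metric
`g_p(u, v) = Re ⟨u, v⟩ / (1 - |p|²) + Re (conj ⟨p, u⟩ * ⟨p, v⟩) / (1 - |p|²)²`,
normalized so that the sectional curvatures lie in `[-4, -1]`
(and the curvature is `-4` if `k = 1`). -/
noncomputable def metric (k : ℕ) (p : EuclideanSpace ℂ (Fin k)) :
    EuclideanSpace ℂ (Fin k) →L[ℝ] EuclideanSpace ℂ (Fin k) →L[ℝ] ℝ :=
  (1 - ‖p‖ ^ 2)⁻¹ • innerSL ℝ +
    ((1 - ‖p‖ ^ 2) ^ 2)⁻¹ •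
      (innerSL ℝ : ℂ →L[ℝ] ℂ →L[ℝ] ℝ).bilinearComp
        ((innerSL ℂ p).restrictScalars ℝ) ((innerSL ℂ p).restrictScalars ℝ)

theorem metric_apply (k : ℕ) (p u v : EuclideanSpace ℂ (Fin k)) :
    metric k p u v = (inner ℂ u v).re / (1 - ‖p‖ ^ 2)
      + (star (inner ℂ p u) * inner ℂ p v).re / (1 - ‖p‖ ^ 2) ^ 2 := by
  have h : (inner ℝ u v : ℝ) = (inner ℂ u v : ℂ).re := by
    simp [PiLp.inner_apply, Complex.inner]
  have h' : (innerSL ℝ u : EuclideanSpace ℂ (Fin k) →L[ℝ] ℝ) v = (inner ℂ u v : ℂ).re := h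
  simp only [metric, add_apply, smul_apply, h', smul_eq_mul,
    ContinuousLinearMap.bilinearComp_apply, innerSL_apply_apply, Complex.inner,
    ContinuousLinearMap.coe_restrictScalars', Complex.star_def]
  rw [mul_comm (inner ℂ p v : ℂ)]
  ring

theorem metric_pos (k : ℕ) (p u : EuclideanSpace ℂ (Fin k)) (hp : p ∈ ball k) (hu : u ≠ 0) :
    0 < metric k p u u := by
  have h1 : ‖p‖ < 1 := by simpa [ball] using hp
  have h2 : 0 < 1 - ‖p‖ ^ 2 := by nlinarith [norm_nonneg p]
  have h3 : 0 < (inner ℂ u u : ℂ).re := by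
    have h := norm_sq_eq_re_inner (𝕜 := ℂ) u
    rw [RCLike.re_eq_complex_re] at h
    rw [← h]
    exact pow_pos (norm_pos_iff.2 hu) 2
  have h4 : 0 ≤ (star (inner ℂ p u : ℂ) * inner ℂ p u).re := by
    simp only [Complex.star_def, ← Complex.normSq_eq_conj_mul_self, Complex.ofReal_re]
    exact Complex.normSq_nonneg _
  rw [metric_apply]
  exact add_pos_of_pos_of_nonneg (div_pos h3 h2) (div_nonneg h4 (sq_nonneg _))

/-- The metric is nondegenerate on the ball, so that `christoffel` is not a default value there. -/
theorem metric_isInvertible (k : ℕ) (p : EuclideanSpace ℂ (Fin k)) (hp : p ∈ ball k) :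
    (metric k p).IsInvertible := by
  have hinj : Function.Injective
      (LinearMap.toContinuousLinearMap.symm.toLinearMap ∘ₗ (metric k p).toLinearMap :
        EuclideanSpace ℂ (Fin k) →ₗ[ℝ] Module.Dual ℝ (EuclideanSpace ℂ (Fin k))) := by
    rw [injective_iff_map_eq_zero]
    intro u hu
    by_contra hne
    have h := metric_pos k p u hp hne
    have h0 : metric k p u u = 0 := by simpa using LinearMap.congr_fun hu u
    exact h.ne' h0
  let e := (LinearEquiv.ofInjectiveOfFinrankEq _ hinj
    (Subspace.dual_finrank_eq (K := ℝ) (V := EuclideanSpace ℂ (Fin k))).symm).trans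
      (LinearMap.toContinuousLinearMap (𝕜 := ℝ) (E := EuclideanSpace ℂ (Fin k)) (F' := ℝ))
  refine ⟨e.toContinuousLinearEquiv, ?_⟩
  ext u v
  rfl

/-- A complex hyperbolic plane: the image under some `exp_b` of the plane spanned by a unit vector
`u` and a unit vector `v ⊥ u` in the `-4`-eigenspace of the curvature operator `R(·, u)u`. -/
def IsComplexPlane (k : ℕ) (E : Set (EuclideanSpace ℂ (Fin k))) : Prop :=
  ∃ b ∈ ball k, ∃ u v : EuclideanSpace ℂ (Fin k),
    metric k b u u = 1 ∧ metric k b v v = 1 ∧ metric k b u v = 0 ∧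
      curvature (metric k) b v u u = (-4 : ℝ) • v ∧
      E = expImage (ball k) (metric k) b (Submodule.span ℝ {u, v})

/-- The complex structure on the tangent spaces. -/
noncomputable def J {k : ℕ} (z : EuclideanSpace ℂ (Fin k)) : EuclideanSpace ℂ (Fin k) :=
  Complex.I • z

/-- The totally geodesic orthogonal complement to `E` at `a`. -/
def orthComplement (k : ℕ) (E : Set (EuclideanSpace ℂ (Fin k))) (a : EuclideanSpace ℂ (Fin k)) :
    Set (EuclideanSpace ℂ (Fin k)) :=
  expImage (ball k) (metric k) a (normalSpace (metric k) E a)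

/-- `C` is a fiber of the fibration of the unit normal sphere of `E` at `a` by complex circles:
`C` is its intersection with the tangent space `T_a L` of a complex hyperbolic plane `L` through
`a` that is contained in the orthogonal complement to `E` at `a`. -/
def IsFiber (k : ℕ) (E : Set (EuclideanSpace ℂ (Fin k))) (a : EuclideanSpace ℂ (Fin k))
    (C : Set (EuclideanSpace ℂ (Fin k))) : Prop :=
  ∃ L : Set (EuclideanSpace ℂ (Fin k)), IsComplexPlane k L ∧ a ∈ L ∧ L ⊆ orthComplement k E a ∧
    C = tangentDirs L a ∩ unitNormalSphere (metric k) E a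

end ComplexHyperbolic

/-!
In the ball model the Levi-Civita connection has the form `Γ_p(u, v) = κ_p(u) v + κ_p(v) u` with a
complex-valued one-form `κ`. Hence the acceleration of a geodesic is a complex multiple of its
velocity, geodesics stay in complex affine lines, and the totally geodesic complex submanifolds
are the intersections of the ball with complex affine subspaces. That such a submanifold is filled
by complete geodesics through each of its points is seen in `ℂ^{k,1}`, where the geodesic from `b`
to `q` is the projectivization of `sinh (d (1 - t)) B + sinh (d t) Q` for suitable lifts `B`, `Q`
of `b`, `q` and their distance `d`.

A normal vector at `a` extends to a field along the submanifold, the projection of a fixed vector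
of `ℂ^{k,1}`, whose covariant derivative along a curve `c` is its multiple by `κ_c(c')`. The
holonomy along a loop `c` is therefore the multiplication of normal vectors by `exp (-∫ κ_c(c'))`,
which preserves the complex circles. For a small nonconstant circle in a complex line the imaginary
part of `∫ κ_c(c')` lies strictly between `0` and `2π`, so the holonomy is not trivial. The
curvature identity is read off from the formula for `R(x, y)z` with `x`, `y` tangent and `z`
normal, where all terms except the multiple of `z` vanish.
-/

namespace ChartGeometry

section LeviCivita

variable {V : Type*} [NormedAddCommGroup V] [NormedSpace ℝ V]
  {g : V → V →L[ℝ] V →L[ℝ] ℝ} {p : V}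

theorem christoffel_sub_right (g : V → V →L[ℝ] V →L[ℝ] ℝ) (p u v w : V) :
    christoffel g p u (v - w) = christoffel g p u v - christoffel g p u w := by
  have hform : koszulForm g p u (v - w) = koszulForm g p u v - koszulForm g p u w := by
    ext x
    simp only [koszulForm, map_sub, smul_apply, sub_apply, add_apply,
      ContinuousLinearMap.flip_apply, smul_eq_mul]
    ring
  rw [christoffel, hform, map_sub, christoffel, christoffel]

theorem covAlong_sub {c X Y : ℝ → V} {t : ℝ} (hX : DifferentiableAt ℝ X t)
    (hY : DifferentiableAt ℝ Y t) :
    covAlong g c (X - Y) t = covAlong g c X t - covAlong g c Y t := by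
  rw [covAlong, covAlong, covAlong, deriv_sub hX hY, Pi.sub_apply, christoffel_sub_right]
  abel

theorem christoffel_eq_of_metric_compatible (hinv : (g p).IsInvertible)
    (hsymm : ∀ u v, g p u v = g p v u) {Γ : V → V → V} (htorsion : ∀ u v, Γ u v = Γ v u)
    (hcompat : ∀ u v w, fderiv ℝ g p u v w = g p (Γ u v) w + g p v (Γ u w)) (u v : V) :
    christoffel g p u v = Γ u v := by
  have hinj : Function.Injective (g p) := by
    obtain ⟨e, he⟩ := hinv
    exact he ▸ e.injective
  apply hinj
  ext w
  rw [metric_christoffel g p hinv, hcompat, hcompat, hcompat, htorsion v u, htorsion w u,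
    htorsion w v, hsymm u (Γ v w), hsymm (Γ u w) v]
  ring

theorem hasDerivAt_metric_along {c X Y : ℝ → V} {c' X' Y' : V} {t : ℝ}
    (hg : DifferentiableAt ℝ g (c t)) (hc : HasDerivAt c c' t) (hX : HasDerivAt X X' t)
    (hY : HasDerivAt Y Y' t) :
    HasDerivAt (fun s => g (c s) (X s) (Y s))
      (fderiv ℝ g (c t) c' (X t) (Y t) + g (c t) X' (Y t) + g (c t) (X t) Y') t := by
  have hgc : HasDerivAt (fun s => g (c s)) (fderiv ℝ g (c t) c') t :=
    HasFDerivAt.comp_hasDerivAt (E := V →L[ℝ] V →L[ℝ] ℝ) (l := g) t hg.hasFDerivAt hc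
  simpa using (hgc.clm_apply hX).clm_apply hY

theorem fderiv_metric_eq_christoffel (hg : DifferentiableAt ℝ g p) (hinv : (g p).IsInvertible)
    (hsymm : ∀ q u v, g q u v = g q v u) (u v w : V) :
    fderiv ℝ g p u v w = g p (christoffel g p u v) w + g p v (christoffel g p u w) := by
  have hline (x y z : V) : HasDerivAt (fun t : ℝ => g (p + t • x) y z) (fderiv ℝ g p x y z) 0 := by
    have hc : HasDerivAt (fun t : ℝ => p + t • x) x 0 := by
      simpa using ((hasDerivAt_id (0 : ℝ)).smul_const x).const_add p
    simpa using hasDerivAt_metric_along (by simpa using hg) hc (hasDerivAt_const 0 y)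
      (hasDerivAt_const 0 z)
  have hswap (x y z : V) : fderiv ℝ g p x y z = fderiv ℝ g p x z y :=
    (hline x y z).unique (by simpa only [hsymm _ y z] using hline x z y)
  rw [hsymm p v, metric_christoffel g p hinv, metric_christoffel g p hinv, hswap u w v]
  ring

theorem hasDerivAt_metric_covAlong {c X Y : ℝ → V} {t : ℝ} (hg : DifferentiableAt ℝ g (c t))
    (hinv : (g (c t)).IsInvertible) (hsymm : ∀ q u v, g q u v = g q v u)
    (hc : DifferentiableAt ℝ c t) (hX : DifferentiableAt ℝ X t) (hY : DifferentiableAt ℝ Y t) :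
    HasDerivAt (fun s => g (c s) (X s) (Y s))
      (g (c t) (covAlong g c X t) (Y t) + g (c t) (X t) (covAlong g c Y t)) t := by
  refine (hasDerivAt_metric_along hg hc.hasDerivAt hX.hasDerivAt hY.hasDerivAt).congr_deriv ?_
  rw [fderiv_metric_eq_christoffel hg hinv hsymm, covAlong, covAlong, map_add, map_add, add_apply]
  ring

end LeviCivita

section ParallelTranslation

variable {V : Type*} [NormedAddCommGroup V] [NormedSpace ℝ V]
  {g : V → V →L[ℝ] V →L[ℝ] ℝ} {E : Set V} {a v w w' : V} {c X Y : ℝ → V}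

theorem IsPiecewiseSmoothLoop.mono {E' : Set V} (hc : IsPiecewiseSmoothLoop E a c) (h : E ⊆ E') :
    IsPiecewiseSmoothLoop E' a c :=
  ⟨hc.1, fun t ht => h (hc.2.1 t ht), hc.2.2⟩

theorem IsPiecewiseSmoothLoop.exists_finset_contDiffAt (hc : IsPiecewiseSmoothLoop E a c) :
    ∃ F : Finset ℝ, ∀ t ∈ Ioo (0 : ℝ) 1, t ∉ F → ContDiffAt ℝ ∞ c t := by
  classical
  obtain ⟨-, -, -, -, n, τ, -, hτ0, hτn, hsmooth⟩ := hc
  refine ⟨(Finset.range (n + 1)).image τ, fun t ht htF => ?_⟩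
  have hex : ∃ j, t < τ j := ⟨n, hτn ▸ ht.2⟩
  have hlt : t < τ (Nat.find hex) := Nat.find_spec hex
  have hle : Nat.find hex ≤ n := Nat.find_min' hex (hτn ▸ ht.2)
  obtain ⟨i, hi⟩ : ∃ i, Nat.find hex = i + 1 := by
    refine Nat.exists_eq_succ_of_ne_zero fun h => ?_
    rw [h, hτ0] at hlt
    exact hlt.not_gt ht.1
  rw [hi] at hlt hle
  have hge : τ i ≤ t := not_lt.1 (Nat.find_min hex (by lia))
  have hne : τ i ≠ t := fun h =>
    htF (Finset.mem_image.2 ⟨i, Finset.mem_range.2 (by lia), h⟩)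
  exact (hsmooth i (by lia)).contDiffAt (Icc_mem_nhds (lt_of_le_of_ne hge hne) hlt)

theorem IsParallelAlong.sub (hX : IsParallelAlong g c X) (hY : IsParallelAlong g c Y) :
    IsParallelAlong g c (X - Y) := by
  classical
  obtain ⟨hXc, F, hF⟩ := hX
  obtain ⟨hYc, G, hG⟩ := hY
  refine ⟨hXc.sub hYc, F ∪ G, fun t ht htFG => ?_⟩
  rw [Finset.mem_union, not_or] at htFG
  obtain ⟨hXd, hXcov⟩ := hF t ht htFG.1
  obtain ⟨hYd, hYcov⟩ := hG t ht htFG.2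
  exact ⟨hXd.sub hYd, by rw [covAlong_sub hXd hYd, hXcov, hYcov, sub_self]⟩

theorem IsParallelAlong.metric_apply_eq (hg : ∀ p ∈ E, DifferentiableAt ℝ g p)
    (hinv : ∀ p ∈ E, (g p).IsInvertible) (hsymm : ∀ p u v, g p u v = g p v u)
    (hc : IsPiecewiseSmoothLoop E a c) (hX : IsParallelAlong g c X) (hY : IsParallelAlong g c Y) :
    g a (X 1) (Y 1) = g a (X 0) (Y 0) := by
  classical
  obtain ⟨H, hH⟩ := hc.exists_finset_contDiffAt
  obtain ⟨hcc, hcE, hc0, hc1, -⟩ := hc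
  obtain ⟨hXc, F, hF⟩ := hX
  obtain ⟨hYc, G, hG⟩ := hY
  have hcont : ContinuousOn (fun t => g (c t) (X t) (Y t)) (uIcc 0 1) := by
    rw [uIcc_of_le zero_le_one]
    have hgc : ContinuousOn (fun t => g (c t)) (Icc 0 1) := fun t ht =>
      (hg _ (hcE t ht)).continuousAt.comp_continuousWithinAt (hcc t ht)
    exact (hgc.clm_apply hXc).clm_apply hYc
  have hderiv : ∀ t ∈ Ioo (min (0 : ℝ) 1) (max 0 1) \ ((F ∪ G ∪ H : Finset ℝ) : Set ℝ),
      HasDerivAt (fun t => g (c t) (X t) (Y t)) 0 t := by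
    rintro t ⟨ht, htFGH⟩
    rw [min_eq_left zero_le_one, max_eq_right zero_le_one] at ht
    simp only [Finset.coe_union, mem_union, SetLike.mem_coe, not_or] at htFGH
    obtain ⟨hXd, hXcov⟩ := hF t ht htFGH.1.1
    obtain ⟨hYd, hYcov⟩ := hG t ht htFGH.1.2
    have htE := hcE t (Ioo_subset_Icc_self ht)
    simpa [hXcov, hYcov] using hasDerivAt_metric_covAlong (hg _ htE) (hinv _ htE) hsymm
      ((hH t ht htFGH.2).differentiableAt (by simp)) hXd hYd
  have hint := MeasureTheory.integral_eq_of_hasDerivAt_off_countable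
    (fun t => g (c t) (X t) (Y t)) (fun _ => 0) (Finset.countable_toSet _) hcont hderiv (by simp)
  rw [intervalIntegral.integral_zero, hc0, hc1] at hint
  linarith

theorem ParallelTranslate.metric_apply_self (hg : ∀ p ∈ E, DifferentiableAt ℝ g p)
    (hinv : ∀ p ∈ E, (g p).IsInvertible) (hsymm : ∀ p u v, g p u v = g p v u)
    (hc : IsPiecewiseSmoothLoop E a c) (h : ParallelTranslate g c v w) :
    g a w w = g a v v := by
  obtain ⟨X, hX, rfl, rfl⟩ := h
  exact hX.metric_apply_eq hg hinv hsymm hc hX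

theorem ParallelTranslate.unique (hg : ∀ p ∈ E, DifferentiableAt ℝ g p)
    (hinv : ∀ p ∈ E, (g p).IsInvertible) (hsymm : ∀ p u v, g p u v = g p v u)
    (hpos : ∀ u ≠ 0, 0 < g a u u) (hc : IsPiecewiseSmoothLoop E a c)
    (h : ParallelTranslate g c v w) (h' : ParallelTranslate g c v w') : w = w' := by
  obtain ⟨X, hX, hX0, rfl⟩ := h
  obtain ⟨Y, hY, hY0, rfl⟩ := h'
  have hdiff : ParallelTranslate g c 0 (X 1 - Y 1) :=
    ⟨X - Y, hX.sub hY, by rw [Pi.sub_apply, hX0, hY0, sub_self], rfl⟩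
  have hzero : g a (X 1 - Y 1) (X 1 - Y 1) = 0 := by
    rw [hdiff.metric_apply_self hg hinv hsymm hc, map_zero]
  by_contra hne
  exact (hpos _ (sub_ne_zero.2 hne)).ne' hzero

end ParallelTranslation

end ChartGeometry

namespace ComplexHyperbolic

open ChartGeometry

section HermitianMetric

variable {V : Type*} [NormedAddCommGroup V] [InnerProductSpace ℂ V]

/-- The complex-valued one-form `κ` on the unit ball through which the Levi-Civita connection of
the complex hyperbolic metric is given by `Γ_p(u, v) = κ_p(u) v + κ_p(v) u`, see
`christoffel_metric`. It is complex linear in `u`. -/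
noncomputable def connectionForm (p u : V) : ℂ :=
  inner ℂ p u / ((1 - ‖p‖ ^ 2 : ℝ) : ℂ)

/-- The Hermitian form, conjugate linear in `u`, with real part the complex hyperbolic metric. -/
noncomputable def hermitianMetric (p u v : V) : ℂ :=
  inner ℂ u v / ((1 - ‖p‖ ^ 2 : ℝ) : ℂ) + star (connectionForm p u) * connectionForm p v

theorem connectionForm_add (p u v : V) :
    connectionForm p (u + v) = connectionForm p u + connectionForm p v := by
  rw [connectionForm, inner_add_right, add_div, connectionForm, connectionForm]

theorem connectionForm_smul (p u : V) (l : ℂ) :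
    connectionForm p (l • u) = l * connectionForm p u := by
  rw [connectionForm, inner_smul_right, mul_div_assoc, connectionForm]

theorem star_hermitianMetric (p u v : V) :
    star (hermitianMetric p u v) = hermitianMetric p v u := by
  simp only [hermitianMetric, Complex.star_def, map_add, map_div₀, map_mul, Complex.conj_conj,
    inner_conj_symm, Complex.conj_ofReal, mul_comm]

theorem hermitianMetric_add_right (p u v w : V) :
    hermitianMetric p u (v + w) = hermitianMetric p u v + hermitianMetric p u w := by
  simp only [hermitianMetric, inner_add_right, connectionForm_add]
  ring

theorem hermitianMetric_smul_right (p u v : V) (l : ℂ) :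
    hermitianMetric p u (l • v) = l * hermitianMetric p u v := by
  simp only [hermitianMetric, inner_smul_right, connectionForm_smul]
  ring

theorem hermitianMetric_add_left (p u v w : V) :
    hermitianMetric p (u + v) w = hermitianMetric p u w + hermitianMetric p v w := by
  simp only [← star_hermitianMetric p w, hermitianMetric_add_right, star_add]

theorem hermitianMetric_smul_left (p u v : V) (l : ℂ) :
    hermitianMetric p (l • u) v = star l * hermitianMetric p u v := by
  simp only [← star_hermitianMetric p v, hermitianMetric_smul_right, star_mul']

theorem ofReal_one_sub_norm_sq (p : V) : ((1 - ‖p‖ ^ 2 : ℝ) : ℂ) = 1 - inner ℂ p p := by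
  rw [inner_self_eq_norm_sq_to_K]
  simp

variable [NormedSpace ℝ V]

theorem contDiffAt_connectionForm {n : WithTop ℕ∞} {q : V × V} (hq : 1 - ‖q.1‖ ^ 2 ≠ 0) :
    ContDiffAt ℝ n (fun q : V × V => connectionForm q.1 q.2) q := by
  have hden : 1 - inner ℂ q.1 q.1 ≠ 0 := by
    rw [← ofReal_one_sub_norm_sq]
    exact_mod_cast hq
  simp only [connectionForm, ofReal_one_sub_norm_sq, div_eq_mul_inv]
  exact (contDiffAt_fst.inner ℂ contDiffAt_snd).mul
    ((contDiffAt_const.sub (contDiffAt_fst.inner ℂ contDiffAt_fst)).inv hden)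

theorem hasDerivAt_connectionForm {c : ℝ → V} {c' : V} {t : ℝ} (hc : HasDerivAt c c' t)
    (ht : 1 - ‖c t‖ ^ 2 ≠ 0) (v : V) :
    HasDerivAt (fun s => connectionForm (c s) v)
      (hermitianMetric (c t) c' v + connectionForm (c t) c' * connectionForm (c t) v) t := by
  have hden : 1 - inner ℂ (c t) (c t) ≠ 0 := by
    rw [← ofReal_one_sub_norm_sq]
    exact_mod_cast ht
  simp only [connectionForm, hermitianMetric, ofReal_one_sub_norm_sq]
  refine ((hc.inner ℂ (hasDerivAt_const t v)).fun_div ((hc.inner ℂ hc).const_sub 1)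
    hden).congr_deriv ?_
  simp only [inner_zero_right, zero_add, star_div₀, Complex.star_def, inner_conj_symm, map_sub,
    map_one]
  field_simp
  ring

theorem hasDerivAt_hermitianMetric {c : ℝ → V} {c' : V} {t : ℝ} (hc : HasDerivAt c c' t)
    (ht : 1 - ‖c t‖ ^ 2 ≠ 0) (v w : V) :
    HasDerivAt (fun s => hermitianMetric (c s) v w)
      (hermitianMetric (c t) (connectionForm (c t) c' • v + connectionForm (c t) v • c') w +
        hermitianMetric (c t) v (connectionForm (c t) c' • w + connectionForm (c t) w • c')) t := by
  have hden : 1 - inner ℂ (c t) (c t) ≠ 0 := by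
    rw [← ofReal_one_sub_norm_sq]
    exact_mod_cast ht
  have hinner : HasDerivAt (fun s => inner ℂ v w / ((1 - ‖c s‖ ^ 2 : ℝ) : ℂ))
      ((connectionForm (c t) c' + star (connectionForm (c t) c')) * inner ℂ v w /
        ((1 - ‖c t‖ ^ 2 : ℝ) : ℂ)) t := by
    simp only [connectionForm, ofReal_one_sub_norm_sq]
    refine ((hasDerivAt_const t (inner ℂ v w)).fun_div ((hc.inner ℂ hc).const_sub 1)
      hden).congr_deriv ?_
    simp only [star_div₀, Complex.star_def, inner_conj_symm, map_sub, map_one]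
    field_simp
    ring
  refine (hinner.add ((hasDerivAt_connectionForm hc ht v).star.mul
    (hasDerivAt_connectionForm hc ht w))).congr_deriv ?_
  simp only [hermitianMetric_add_left, hermitianMetric_add_right, hermitianMetric_smul_left,
    hermitianMetric_smul_right, star_add, star_mul', star_hermitianMetric]
  simp only [hermitianMetric]
  ring

end HermitianMetric

section LeviCivita

variable {k : ℕ} {p : EuclideanSpace ℂ (Fin k)}

theorem one_sub_norm_sq_pos (hp : p ∈ ball k) : 0 < 1 - ‖p‖ ^ 2 := by
  have hp1 : ‖p‖ < 1 := mem_ball_zero_iff.1 hp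
  nlinarith [norm_nonneg p]

theorem metric_eq_re_hermitianMetric (p u v : EuclideanSpace ℂ (Fin k)) :
    metric k p u v = (hermitianMetric p u v).re := by
  simp only [metric_apply, hermitianMetric, connectionForm, star_div₀, Complex.star_def,
    Complex.conj_ofReal, div_mul_div_comm, ← Complex.ofReal_mul, Complex.add_re,
    Complex.div_ofReal_re, sq]

theorem metric_symm (p u v : EuclideanSpace ℂ (Fin k)) : metric k p u v = metric k p v u := by
  rw [metric_eq_re_hermitianMetric, metric_eq_re_hermitianMetric, ← star_hermitianMetric,
    Complex.star_def, Complex.conj_re]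

theorem hermitianMetric_self (p u : EuclideanSpace ℂ (Fin k)) :
    hermitianMetric p u u = (metric k p u u : ℂ) := by
  rw [metric_eq_re_hermitianMetric]
  exact (Complex.conj_eq_iff_re.1 (star_hermitianMetric p u u)).symm

theorem hasDerivAt_line (p u : EuclideanSpace ℂ (Fin k)) :
    HasDerivAt (fun t : ℝ => p + t • u) u 0 := by
  simpa using ((hasDerivAt_id (0 : ℝ)).smul_const u).const_add p

theorem differentiableAt_connectionForm (hp : p ∈ ball k) (v : EuclideanSpace ℂ (Fin k)) :
    DifferentiableAt ℝ (fun q => connectionForm q v) p :=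
  ((contDiffAt_connectionForm (n := 1) (q := (p, v)) (one_sub_norm_sq_pos hp).ne').comp p
    (contDiffAt_id.prodMk contDiffAt_const)).differentiableAt one_ne_zero

theorem differentiableAt_metric (hp : p ∈ ball k) : DifferentiableAt ℝ (metric k) p := by
  have hsmooth : ContDiffOn ℝ 1 (metric k) (ball k) := by
    refine contDiffOn_clm_apply.2 fun u => contDiffOn_clm_apply.2 fun v q hq => ?_
    have hκ (w : EuclideanSpace ℂ (Fin k)) : ContDiffAt ℝ 1 (fun q => connectionForm q w) q :=
      (contDiffAt_connectionForm (q := (q, w)) (one_sub_norm_sq_pos hq).ne').comp q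
        (contDiffAt_id.prodMk contDiffAt_const)
    have hden : ContDiffAt ℝ 1 (fun q : EuclideanSpace ℂ (Fin k) => ((1 - ‖q‖ ^ 2 : ℝ) : ℂ)) q :=
      Complex.ofRealCLM.contDiff.contDiffAt.comp q
        (contDiffAt_const.sub (contDiff_norm_sq ℝ).contDiffAt)
    have hden_inv := hden.inv (Complex.ofReal_ne_zero.2 (one_sub_norm_sq_pos hq).ne')
    have hstar := Complex.conjCLE.contDiff.contDiffAt.comp q (hκ u)
    simp only [metric_eq_re_hermitianMetric, hermitianMetric, div_eq_mul_inv]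
    exact (Complex.reCLM.contDiff.contDiffAt.comp q
      ((contDiffAt_const.mul hden_inv).add (hstar.mul (hκ v)))).contDiffWithinAt
  exact (hsmooth.contDiffAt (Metric.isOpen_ball.mem_nhds hp)).differentiableAt one_ne_zero

theorem fderiv_metric_apply (hp : p ∈ ball k) (u v w : EuclideanSpace ℂ (Fin k)) :
    fderiv ℝ (metric k) p u v w =
      metric k p (connectionForm p u • v + connectionForm p v • u) w +
        metric k p v (connectionForm p u • w + connectionForm p w • u) := by
  have hp0 : p + (0 : ℝ) • u = p := by rw [zero_smul, add_zero]
  have hmetric := hasDerivAt_metric_along (g := metric k)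
    (hp0.symm ▸ differentiableAt_metric hp) (hasDerivAt_line p u) (hasDerivAt_const 0 v)
    (hasDerivAt_const 0 w)
  have hre := Complex.reCLM.hasFDerivAt.comp_hasDerivAt (0 : ℝ) (hasDerivAt_hermitianMetric
    (hasDerivAt_line p u) (hp0.symm ▸ (one_sub_norm_sq_pos hp).ne') v w)
  simp only [Function.comp_def, Complex.reCLM_apply, ← metric_eq_re_hermitianMetric, map_zero,
    zero_apply, add_zero, hp0] at hmetric hre
  rw [hmetric.unique hre, Complex.add_re, metric_eq_re_hermitianMetric,
    metric_eq_re_hermitianMetric]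

theorem christoffel_metric (hp : p ∈ ball k) (u v : EuclideanSpace ℂ (Fin k)) :
    christoffel (metric k) p u v = connectionForm p u • v + connectionForm p v • u :=
  christoffel_eq_of_metric_compatible (metric_isInvertible k p hp) (metric_symm p)
    (fun u v => add_comm (connectionForm p u • v) (connectionForm p v • u))
    (fderiv_metric_apply hp) u v

theorem covAlong_metric {c : ℝ → EuclideanSpace ℂ (Fin k)} {t : ℝ} (ht : c t ∈ ball k)
    (X : ℝ → EuclideanSpace ℂ (Fin k)) :
    covAlong (metric k) c X t =
      deriv X t +
        (connectionForm (c t) (deriv c t) • X t + connectionForm (c t) (X t) • deriv c t) := by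
  rw [covAlong, christoffel_metric ht]

theorem fderiv_connectionForm_apply (hp : p ∈ ball k) (u v : EuclideanSpace ℂ (Fin k)) :
    fderiv ℝ (fun q => connectionForm q v) p u =
      hermitianMetric p u v + connectionForm p u * connectionForm p v := by
  have hp0 : p + (0 : ℝ) • u = p := by rw [zero_smul, add_zero]
  rw [← (differentiableAt_connectionForm hp v).lineDeriv_eq_fderiv, lineDeriv]
  simpa only [hp0] using (hasDerivAt_connectionForm (hasDerivAt_line p u)
    (hp0.symm ▸ (one_sub_norm_sq_pos hp).ne') v).deriv

theorem cov_cov_const (hp : p ∈ ball k) (x y z : EuclideanSpace ℂ (Fin k)) :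
    cov (metric k) (fun _ => x) (cov (metric k) (fun _ => y) (fun _ => z)) p =
      (hermitianMetric p x y + connectionForm p x * connectionForm p y) • z +
      (hermitianMetric p x z + connectionForm p x * connectionForm p z) • y +
      (connectionForm p x • (connectionForm p y • z + connectionForm p z • y) +
        (2 * connectionForm p y * connectionForm p z) • x) := by
  have hcov : cov (metric k) (fun _ => y) (fun _ => z) =ᶠ[𝓝 p]
      fun q => connectionForm q y • z + connectionForm q z • y := by
    filter_upwards [Metric.isOpen_ball.mem_nhds hp] with q hq
    rw [cov, fderiv_fun_const, Pi.zero_apply, zero_apply, zero_add, christoffel_metric hq]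
  have hderiv := ((differentiableAt_connectionForm hp y).hasFDerivAt.smul_const z).fun_add
    ((differentiableAt_connectionForm hp z).hasFDerivAt.smul_const y)
  rw [cov, hcov.fderiv_eq, hderiv.fderiv, hcov.eq_of_nhds, christoffel_metric hp, add_apply,
    ContinuousLinearMap.smulRight_apply, ContinuousLinearMap.smulRight_apply,
    fderiv_connectionForm_apply hp, fderiv_connectionForm_apply hp, connectionForm_add,
    connectionForm_smul, connectionForm_smul]
  module

theorem curvature_metric (hp : p ∈ ball k) (x y z : EuclideanSpace ℂ (Fin k)) :
    curvature (metric k) p x y z =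
      (hermitianMetric p x y - hermitianMetric p y x) • z + hermitianMetric p x z • y -
        hermitianMetric p y z • x := by
  rw [curvature, cov_cov_const hp, cov_cov_const hp]
  module

end LeviCivita

section ClosedSubmodule

variable {V : Type*} [NormedAddCommGroup V] [NormedSpace ℝ V] {S : Submodule ℝ V} {c : ℝ → V}

theorem sub_mem_of_forall_deriv_mem (hS : IsClosed (S : Set V)) (hc : Differentiable ℝ c)
    (h : ∀ t, deriv c t ∈ S) (s t : ℝ) : c s - c t ∈ S := by
  have hquot (r : ℝ) : HasDerivAt (S.mkQL ∘ c) 0 r := by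
    refine (S.mkQL.hasFDerivAt.comp_hasDerivAt r (hc r).hasDerivAt).congr_deriv ?_
    exact (Submodule.Quotient.mk_eq_zero S).2 (h r)
  exact (Submodule.Quotient.eq S).1 (is_const_of_deriv_eq_zero
    (fun r => (hquot r).differentiableAt) (fun r => (hquot r).deriv) s t)

theorem mem_of_eventually_sub_mem (hS : IsClosed (S : Set V)) {a c' : V} {t : ℝ}
    (hc : HasDerivAt c c' t) (h : ∀ᶠ s in 𝓝 t, c s - a ∈ S) : c' ∈ S := by
  have hconst : S.mkQL ∘ c =ᶠ[𝓝 t] fun _ => S.mkQL a :=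
    h.mono fun s hs => (Submodule.Quotient.eq S).2 hs
  exact (Submodule.Quotient.mk_eq_zero S).1 ((S.mkQL.hasFDerivAt.comp_hasDerivAt t hc).unique
    ((hasDerivAt_const t _).congr_of_eventuallyEq hconst))

end ClosedSubmodule

theorem eq_exp_integral_smul_of_hasDerivAt {V : Type*} [NormedAddCommGroup V] [NormedSpace ℂ V]
    [NormedSpace ℝ V] [IsScalarTower ℝ ℂ V] {X : ℝ → V} {f : ℝ → ℂ} (hf : Continuous f)
    (hX : ∀ t, HasDerivAt X (f t • X t) t) (t : ℝ) :
    X t = Complex.exp (∫ s in (0 : ℝ)..t, f s) • X 0 := by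
  have hconst (s : ℝ) :
      HasDerivAt (fun s => Complex.exp (-∫ r in (0 : ℝ)..s, f r) • X s) 0 s := by
    refine ((hf.integral_hasStrictDerivAt 0 s).hasDerivAt.fun_neg.cexp.fun_smul
      (hX s)).congr_deriv ?_
    module
  have heq := is_const_of_deriv_eq_zero (fun s => (hconst s).differentiableAt)
    (fun s => (hconst s).deriv) t 0
  simp only [intervalIntegral.integral_same, neg_zero, Complex.exp_zero, one_smul] at heq
  rw [← heq, smul_smul, ← Complex.exp_add, add_neg_cancel, Complex.exp_zero, one_smul]

theorem coe_span_real_pair_smul {V : Type*} [AddCommGroup V] [Module ℂ V] [Module ℝ V]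
    [IsScalarTower ℝ ℂ V] (u : V) {l : ℂ} (hl : l.im ≠ 0) :
    (Submodule.span ℝ {u, l • u} : Set V) = Submodule.span ℂ {u} := by
  ext x
  simp only [SetLike.mem_coe, Submodule.mem_span_pair, Submodule.mem_span_singleton]
  constructor
  · rintro ⟨α, β, rfl⟩
    exact ⟨α + β * l, by module⟩
  · rintro ⟨m, rfl⟩
    refine ⟨m.re - m.im / l.im * l.re, m.im / l.im, ?_⟩
    have hm : m = ((m.re - m.im / l.im * l.re : ℝ) : ℂ) + ((m.im / l.im : ℝ) : ℂ) * l :=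
      Complex.ext (by simp) (by simp [hl])
    conv_rhs => rw [hm]
    module

section LorentzModel

variable {V : Type*} [NormedAddCommGroup V] [InnerProductSpace ℂ V]

/-- The Hermitian form of signature `(1, n)` on `V × ℂ`, conjugate linear in the first argument.
The unit ball of `V` is the set of points `X.2⁻¹ • X.1` for `X` with `‖X.1‖ < ‖X.2‖`, and complex
hyperbolic geodesics are the images of the curves `X'' = l X` with `lorentzForm X X' = 0`. -/
noncomputable def lorentzForm : (V × ℂ) →ₗ⋆[ℂ] (V × ℂ) →ₗ[ℂ] ℂ :=
  LinearMap.mk₂'ₛₗ (starRingEnd ℂ) (RingHom.id ℂ)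
    (fun X Y => star X.2 * Y.2 - inner ℂ X.1 Y.1)
    (fun X Y Z => by
      rw [Prod.snd_add, Prod.fst_add, star_add, inner_add_left]
      ring)
    (fun l X Y => by
      rw [Prod.smul_snd, Prod.smul_fst, smul_eq_mul, star_mul', inner_smul_left, smul_eq_mul,
        Complex.star_def]
      ring)
    (fun X Y Z => by
      rw [Prod.snd_add, Prod.fst_add, inner_add_right]
      ring)
    (fun l X Y => by
      rw [Prod.smul_snd, Prod.smul_fst, smul_eq_mul, inner_smul_right, RingHom.id_apply,
        smul_eq_mul]
      ring)

theorem lorentzForm_apply (X Y : V × ℂ) :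
    lorentzForm X Y = star X.2 * Y.2 - inner ℂ X.1 Y.1 :=
  rfl

theorem lorentzForm_self (X : V × ℂ) : lorentzForm X X = ((‖X.2‖ ^ 2 - ‖X.1‖ ^ 2 : ℝ) : ℂ) := by
  rw [lorentzForm_apply, Complex.star_def, Complex.conj_mul', inner_self_eq_norm_sq_to_K]
  simp

theorem star_lorentzForm (X Y : V × ℂ) : star (lorentzForm X Y) = lorentzForm Y X := by
  simp only [lorentzForm_apply, Complex.star_def, map_sub, map_mul, Complex.conj_conj,
    inner_conj_symm, mul_comm]

theorem norm_inv_smul_lt_one {X : V × ℂ} (hX : ‖X.1‖ < ‖X.2‖) : ‖X.2⁻¹ • X.1‖ < 1 := by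
  rw [norm_smul, norm_inv, inv_mul_lt_one₀ ((norm_nonneg _).trans_lt hX)]
  exact hX

theorem connectionForm_lorentz {X Y : V × ℂ} (hX : ‖X.1‖ < ‖X.2‖) :
    connectionForm (X.2⁻¹ • X.1) (X.2⁻¹ ^ 2 • (X.2 • Y.1 - Y.2 • X.1)) =
      Y.2 / X.2 - lorentzForm X Y / lorentzForm X X := by
  have hX2 : X.2 ≠ 0 := norm_pos_iff.1 ((norm_nonneg _).trans_lt hX)
  have hX2' : star X.2 ≠ 0 := star_ne_zero.2 hX2
  have hXX : lorentzForm X X ≠ 0 := by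
    rw [lorentzForm_self, Complex.ofReal_ne_zero]
    nlinarith [norm_nonneg X.1]
  have hden : ((1 - ‖X.2⁻¹ • X.1‖ ^ 2 : ℝ) : ℂ) = lorentzForm X X / (star X.2 * X.2) := by
    rw [ofReal_one_sub_norm_sq, inner_smul_left, inner_smul_right, lorentzForm_apply, map_inv₀,
      ← Complex.star_def]
    field_simp
  have hXY : inner ℂ X.1 Y.1 = star X.2 * Y.2 - lorentzForm X Y := by
    rw [lorentzForm_apply, sub_sub_cancel]
  have hself : inner ℂ X.1 X.1 = star X.2 * X.2 - lorentzForm X X := by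
    rw [lorentzForm_apply, sub_sub_cancel]
  rw [connectionForm, hden, inner_smul_left, inner_smul_right, inner_sub_right, inner_smul_right,
    inner_smul_right, hXY, hself, map_inv₀, ← Complex.star_def]
  field_simp
  ring

theorem mul_lt_norm_one_sub_inner_sq {b q : V} (hb : ‖b‖ < 1) (hq : ‖q‖ < 1) (hne : q ≠ b) :
    (1 - ‖b‖ ^ 2) * (1 - ‖q‖ ^ 2) < ‖1 - inner ℂ b q‖ ^ 2 := by
  have hb' : 0 < 1 - ‖b‖ ^ 2 := by nlinarith [norm_nonneg b]
  have hq' : 0 < 1 - ‖q‖ ^ 2 := by nlinarith [norm_nonneg q]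
  have hdist : 0 < ‖b - q‖ ^ 2 := pow_pos (norm_pos_iff.2 (sub_ne_zero.2 hne.symm)) 2
  have hexpand : ‖b - q‖ ^ 2 = ‖b‖ ^ 2 - 2 * (inner ℂ b q).re + ‖q‖ ^ 2 :=
    norm_sub_sq (𝕜 := ℂ) b q
  have hre : 1 - (inner ℂ b q).re ≤ ‖1 - inner ℂ b q‖ := by
    simpa using Complex.re_le_norm (1 - inner ℂ b q)
  have hmean : ((1 - ‖b‖ ^ 2) + (1 - ‖q‖ ^ 2) + ‖b - q‖ ^ 2) / 2 ≤ ‖1 - inner ℂ b q‖ := by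
    linarith
  have hsq := pow_le_pow_left₀ (by positivity) hmean 2
  nlinarith [sq_nonneg (‖b‖ ^ 2 - ‖q‖ ^ 2)]

theorem exists_lorentzForm_smul_eq_cosh {b q : V} (hb : ‖b‖ < 1) (hq : ‖q‖ < 1) (hne : q ≠ b) :
    ∃ s : ℝ, 0 < s ∧ ∃ l : ℂ, l ≠ 0 ∧
      lorentzForm (l • (q, 1)) (l • (q, 1)) = lorentzForm (b, 1) (b, 1) ∧
      lorentzForm (b, 1) (l • (q, 1)) = (Real.cosh s : ℂ) * lorentzForm (b, 1) (b, 1) := by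
  have hb' : 0 < 1 - ‖b‖ ^ 2 := by nlinarith [norm_nonneg b]
  have hq' : 0 < 1 - ‖q‖ ^ 2 := by nlinarith [norm_nonneg q]
  have hlt := mul_lt_norm_one_sub_inner_sq hb hq hne
  set z : ℂ := 1 - inner ℂ b q with hz
  have hz0 : z ≠ 0 := fun h => by
    rw [h, norm_zero] at hlt
    nlinarith [mul_pos hb' hq']
  set C : ℝ := √(‖z‖ ^ 2 / ((1 - ‖b‖ ^ 2) * (1 - ‖q‖ ^ 2)))
  have hCsq : C ^ 2 = ‖z‖ ^ 2 / ((1 - ‖b‖ ^ 2) * (1 - ‖q‖ ^ 2)) := Real.sq_sqrt (by positivity)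
  have hC1 : 1 < C := Real.lt_sqrt_of_sq_lt (by rwa [one_pow, one_lt_div (mul_pos hb' hq')])
  have hbb : lorentzForm (b, 1) (b, 1) = ((1 - ‖b‖ ^ 2 : ℝ) : ℂ) := by
    simp [lorentzForm_self]
  refine ⟨Real.arcosh C, Real.arcosh_pos hC1, C * (1 - ‖b‖ ^ 2 : ℝ) / z, ?_, ?_, ?_⟩
  · have hC0 : (C : ℂ) ≠ 0 := Complex.ofReal_ne_zero.2 (zero_lt_one.trans hC1).ne'
    exact div_ne_zero (mul_ne_zero hC0 (Complex.ofReal_ne_zero.2 hb'.ne')) hz0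
  · have hzn : ‖z‖ ≠ 0 := norm_ne_zero_iff.2 hz0
    rw [hbb, lorentzForm_self, Complex.ofReal_inj]
    simp only [Prod.smul_fst, Prod.smul_snd, norm_smul, norm_div, norm_mul, Complex.norm_real,
      Real.norm_eq_abs, norm_one, mul_one, mul_pow, div_pow, sq_abs, hCsq]
    field_simp
  · rw [hbb, Real.cosh_arcosh hC1.le, map_smul, lorentzForm_apply, star_one, one_mul, ← hz,
      smul_eq_mul, div_mul_cancel₀ _ hz0]

end LorentzModel

section HyperbolicInterpolation

variable {V : Type*} [NormedAddCommGroup V] [NormedSpace ℝ V]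

/-- The solution of `X'' = s² X` with `X 0 = sinh s • P` and `X 1 = sinh s • Q`. The geodesic of
the unit ball from `P` to `Q` is its projection, see `isGeodesic_sinhInterp`. -/
noncomputable def sinhInterp (s : ℝ) (P Q : V) (t : ℝ) : V :=
  Real.sinh (s * (1 - t)) • P + Real.sinh (s * t) • Q

/-- The derivative of `sinhInterp s P Q`, divided by `s`. -/
noncomputable def coshInterp (s : ℝ) (P Q : V) (t : ℝ) : V :=
  Real.cosh (s * t) • Q - Real.cosh (s * (1 - t)) • P

theorem sinhInterp_zero (s : ℝ) (P Q : V) : sinhInterp s P Q 0 = Real.sinh s • P := by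
  simp [sinhInterp]

theorem sinhInterp_one (s : ℝ) (P Q : V) : sinhInterp s P Q 1 = Real.sinh s • Q := by
  simp [sinhInterp]

theorem contDiff_sinhInterp {n : WithTop ℕ∞} (s : ℝ) (P Q : V) :
    ContDiff ℝ n (sinhInterp s P Q) :=
  ((contDiff_const.mul (contDiff_const.sub contDiff_id)).sinh.smul contDiff_const).add
    ((contDiff_const.mul contDiff_id).sinh.smul contDiff_const)

theorem hasDerivAt_sinhInterp (s : ℝ) (P Q : V) (t : ℝ) :
    HasDerivAt (sinhInterp s P Q) (s • coshInterp s P Q t) t := by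
  have h0 := (((hasDerivAt_id t).const_sub 1).const_mul s).sinh.smul_const P
  have h1 := ((hasDerivAt_id t).const_mul s).sinh.smul_const Q
  refine (h0.add h1).congr_deriv ?_
  simp only [coshInterp, id_eq]
  module

theorem hasDerivAt_smul_coshInterp (s : ℝ) (P Q : V) (t : ℝ) :
    HasDerivAt (fun t => s • coshInterp s P Q t) (s ^ 2 • sinhInterp s P Q t) t := by
  have h0 := (((hasDerivAt_id t).const_sub 1).const_mul s).cosh.smul_const P
  have h1 := ((hasDerivAt_id t).const_mul s).cosh.smul_const Q
  refine ((h1.sub h0).const_smul s).congr_deriv ?_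
  simp only [sinhInterp, id_eq]
  module

theorem sinh_sq_add_sinh_sq_add (x y : ℝ) :
    Real.sinh x ^ 2 + Real.sinh y ^ 2 + 2 * Real.cosh (x + y) * (Real.sinh x * Real.sinh y) =
      Real.sinh (x + y) ^ 2 := by
  rw [Real.cosh_add, Real.sinh_add]
  linear_combination -Real.sinh y ^ 2 * Real.cosh_sq x - Real.sinh x ^ 2 * Real.cosh_sq y

theorem sinh_mul_cosh_sub_sinh_mul_cosh (x y : ℝ) :
    Real.sinh x * Real.cosh x - Real.sinh y * Real.cosh y =
      Real.cosh (x + y) * (Real.sinh x * Real.cosh y - Real.sinh y * Real.cosh x) := by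
  rw [Real.cosh_add]
  linear_combination Real.sinh y * Real.cosh y * Real.cosh_sq x -
    Real.sinh x * Real.cosh x * Real.cosh_sq y

variable [InnerProductSpace ℂ V] [IsScalarTower ℝ ℂ V] {P Q : V × ℂ} {s : ℝ}

theorem lorentzForm_smul_add_smul (hQQ : lorentzForm Q Q = lorentzForm P P)
    (hPQ : lorentzForm P Q = (s : ℂ) * lorentzForm P P) (x y x' y' : ℝ) :
    lorentzForm (x • P + y • Q) (x' • P + y' • Q) =
      ((x * x' + y * y' + s * (x * y' + y * x') : ℝ) : ℂ) * lorentzForm P P := by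
  have hQP : lorentzForm Q P = (s : ℂ) * lorentzForm P P := by
    rw [← star_lorentzForm, hPQ, star_mul', star_lorentzForm, Complex.star_def, Complex.conj_ofReal]
  have hcoe (r : ℝ) (X : V × ℂ) : r • X = (r : ℂ) • X :=
    Prod.ext (RCLike.real_smul_eq_coe_smul _ _) (RCLike.real_smul_eq_coe_smul _ _)
  simp only [hcoe, map_add, LinearMap.add_apply, map_smulₛₗ, LinearMap.smul_apply, hQQ, hPQ, hQP,
    Complex.conj_ofReal, RingHom.id_apply, smul_eq_mul]
  push_cast
  ring

theorem lorentzForm_sinhInterp_self (hQQ : lorentzForm Q Q = lorentzForm P P)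
    (hPQ : lorentzForm P Q = (Real.cosh s : ℂ) * lorentzForm P P) (t : ℝ) :
    lorentzForm (sinhInterp s P Q t) (sinhInterp s P Q t) =
      (Real.sinh s ^ 2 : ℝ) * lorentzForm P P := by
  have hsinh := sinh_sq_add_sinh_sq_add (s * (1 - t)) (s * t)
  rw [← mul_add, sub_add_cancel, mul_one] at hsinh
  rw [sinhInterp, lorentzForm_smul_add_smul hQQ hPQ, ← hsinh]
  congr 2
  ring

theorem lorentzForm_sinhInterp_coshInterp (hQQ : lorentzForm Q Q = lorentzForm P P)
    (hPQ : lorentzForm P Q = (Real.cosh s : ℂ) * lorentzForm P P) (t : ℝ) :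
    lorentzForm (sinhInterp s P Q t) (coshInterp s P Q t) = 0 := by
  have hsinh := sinh_mul_cosh_sub_sinh_mul_cosh (s * (1 - t)) (s * t)
  rw [← mul_add, sub_add_cancel, mul_one] at hsinh
  have hcosh : coshInterp s P Q t = (-Real.cosh (s * (1 - t))) • P + Real.cosh (s * t) • Q := by
    rw [coshInterp]
    module
  rw [sinhInterp, hcosh, lorentzForm_smul_add_smul hQQ hPQ, mul_eq_zero, Complex.ofReal_eq_zero]
  left
  linear_combination -hsinh

theorem norm_sinhInterp_lt (hs : 0 < s) (hP : ‖P.1‖ < ‖P.2‖)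
    (hQQ : lorentzForm Q Q = lorentzForm P P)
    (hPQ : lorentzForm P Q = (Real.cosh s : ℂ) * lorentzForm P P) (t : ℝ) :
    ‖sinhInterp s P.1 Q.1 t‖ < ‖sinhInterp s P.2 Q.2 t‖ := by
  have hself := lorentzForm_sinhInterp_self hQQ hPQ t
  rw [lorentzForm_self, lorentzForm_self, ← Complex.ofReal_mul, Complex.ofReal_inj] at hself
  have hpos : 0 < Real.sinh s ^ 2 * (‖P.2‖ ^ 2 - ‖P.1‖ ^ 2) :=
    mul_pos (pow_pos (Real.sinh_pos_iff.2 hs) 2) (by nlinarith [norm_nonneg P.1])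
  exact lt_of_pow_lt_pow_left₀ 2 (norm_nonneg _) (sub_pos.1 (hself ▸ hpos))

end HyperbolicInterpolation

section Geodesics

variable {k : ℕ}

theorem isGeodesic_inv_smul {X X' : ℝ → EuclideanSpace ℂ (Fin k)} {w w' l : ℝ → ℂ}
    (hXs : ContDiff ℝ ∞ X) (hws : ContDiff ℝ ∞ w) (hX : ∀ t, HasDerivAt X (X' t) t)
    (hw : ∀ t, HasDerivAt w (w' t) t) (hX' : ∀ t, HasDerivAt X' (l t • X t) t)
    (hw' : ∀ t, HasDerivAt w' (l t * w t) t) (hlt : ∀ t, ‖X t‖ < ‖w t‖)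
    (horth : ∀ t, lorentzForm (X t, w t) (X' t, w' t) = 0) :
    IsGeodesic (ball k) (metric k) fun t => (w t)⁻¹ • X t := by
  have hw0 (t : ℝ) : w t ≠ 0 := norm_pos_iff.1 ((norm_nonneg _).trans_lt (hlt t))
  have hinv (t : ℝ) : HasDerivAt (fun t => (w t)⁻¹) (-w' t / w t ^ 2) t :=
    (hw t).fun_inv (hw0 t)
  have hderiv (t : ℝ) : HasDerivAt (fun t => (w t)⁻¹ • X t)
      ((w t)⁻¹ ^ 2 • (w t • X' t - w' t • X t)) t := by
    refine ((hinv t).fun_smul (hX t)).congr_deriv ?_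
    match_scalars <;> field_simp [hw0 t]
  have hwronskian (t : ℝ) : HasDerivAt (fun t => w t • X' t - w' t • X t) 0 t := by
    refine (((hw t).fun_smul (hX' t)).fun_sub ((hw' t).fun_smul (hX t))).congr_deriv ?_
    module
  refine ⟨(hws.inv hw0).smul hXs, fun t => ?_⟩
  have ht : (w t)⁻¹ • X t ∈ ball k :=
    mem_ball_zero_iff.2 (norm_inv_smul_lt_one (X := (X t, w t)) (hlt t))
  have hκ := connectionForm_lorentz (X := (X t, w t)) (Y := (X' t, w' t)) (hlt t)
  rw [horth t, zero_div, sub_zero] at hκ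
  refine ⟨ht, ?_⟩
  have hderiv_eq := funext fun s => (hderiv s).deriv
  have hderiv_deriv : HasDerivAt (fun t => (w t)⁻¹ ^ 2 • (w t • X' t - w' t • X t))
      ((-2 * (w' t / w t)) • (w t)⁻¹ ^ 2 • (w t • X' t - w' t • X t)) t := by
    refine (((hinv t).fun_pow 2).fun_smul (hwronskian t)).congr_deriv ?_
    rw [smul_zero, zero_add, smul_smul]
    congr 1
    simp only [Nat.add_one_sub_one, Nat.cast_ofNat]
    field_simp [hw0 t]
  rw [covAlong_metric (c := fun t => (w t)⁻¹ • X t) ht, hderiv_eq, hderiv_deriv.deriv, hκ]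
  module

theorem isGeodesic_sinhInterp {P Q : EuclideanSpace ℂ (Fin k) × ℂ} {s : ℝ} (hs : 0 < s)
    (hP : ‖P.1‖ < ‖P.2‖) (hQQ : lorentzForm Q Q = lorentzForm P P)
    (hPQ : lorentzForm P Q = (Real.cosh s : ℂ) * lorentzForm P P) :
    IsGeodesic (ball k) (metric k)
      fun t => (sinhInterp s P.2 Q.2 t)⁻¹ • sinhInterp s P.1 Q.1 t := by
  refine isGeodesic_inv_smul (l := fun _ => ((s ^ 2 : ℝ) : ℂ)) (contDiff_sinhInterp s P.1 Q.1)
    (contDiff_sinhInterp s P.2 Q.2) (hasDerivAt_sinhInterp s P.1 Q.1)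
    (hasDerivAt_sinhInterp s P.2 Q.2) (fun t => ?_) (fun t => ?_) (fun t => ?_) (fun t => ?_)
  · exact hasDerivAt_smul_coshInterp s P.1 Q.1 t
  · exact hasDerivAt_smul_coshInterp s P.2 Q.2 t
  · exact norm_sinhInterp_lt hs hP hQQ hPQ t
  · have hsmul : s • coshInterp s P Q t = (s : ℂ) • coshInterp s P Q t :=
      Prod.ext (RCLike.real_smul_eq_coe_smul _ _) (RCLike.real_smul_eq_coe_smul _ _)
    change lorentzForm (sinhInterp s P Q t) (s • coshInterp s P Q t) = 0
    rw [hsmul, map_smul, lorentzForm_sinhInterp_coshInterp hQQ hPQ, smul_zero]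

theorem exists_isGeodesic {b q : EuclideanSpace ℂ (Fin k)} (hb : b ∈ ball k) (hq : q ∈ ball k) :
    ∃ c, IsGeodesic (ball k) (metric k) c ∧ c 0 = b ∧ c 1 = q ∧
      ∀ t, c t - b ∈ Submodule.span ℂ {q - b} := by
  rcases eq_or_ne q b with rfl | hne
  · refine ⟨fun _ => q, ⟨contDiff_const, fun t => ⟨hq, ?_⟩⟩, rfl, rfl, fun t => ?_⟩
    · simp [covAlong_metric (c := fun _ => q) (t := t) hq]
    · rw [sub_self]
      exact zero_mem _
  obtain ⟨s, hs, l, hl, hQQ, hPQ⟩ := exists_lorentzForm_smul_eq_cosh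
    (mem_ball_zero_iff.1 hb) (mem_ball_zero_iff.1 hq) hne
  have hb' : ‖b‖ < ‖(1 : ℂ)‖ := by
    rw [norm_one]
    exact mem_ball_zero_iff.1 hb
  have hsinh : (Real.sinh s : ℂ) ≠ 0 := Complex.ofReal_ne_zero.2 (Real.sinh_pos_iff.2 hs).ne'
  refine ⟨_, isGeodesic_sinhInterp (P := (b, 1)) hs hb' hQQ hPQ, ?_, ?_, fun t => ?_⟩
  · rw [sinhInterp_zero, sinhInterp_zero, ← Complex.coe_smul, ← Complex.coe_smul, smul_eq_mul,
      mul_one, inv_smul_smul₀ hsinh]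
  · rw [sinhInterp_one, sinhInterp_one, ← Complex.coe_smul, ← Complex.coe_smul]
    simp only [Prod.smul_fst, Prod.smul_snd, smul_eq_mul, mul_one, smul_smul]
    rw [inv_mul_cancel₀ (mul_ne_zero hsinh hl), one_smul]
  · have hw : sinhInterp s (1 : ℂ) (l • 1) t ≠ 0 := norm_pos_iff.1
      ((norm_nonneg _).trans_lt (norm_sinhInterp_lt (P := (b, 1)) hs hb' hQQ hPQ t))
    have hdiff : sinhInterp s b (l • q) t - sinhInterp s (1 : ℂ) (l • 1) t • b =
        (Real.sinh (s * t) * l) • (q - b) := by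
      simp only [sinhInterp, ← Complex.coe_smul]
      module
    refine Submodule.mem_span_singleton.2
      ⟨(sinhInterp s 1 (l • 1) t)⁻¹ * (Real.sinh (s * t) * l), ?_⟩
    rw [mul_smul, ← hdiff, smul_sub, inv_smul_smul₀ hw]
    rfl

end Geodesics

section Slices

variable {k : ℕ} {a b p z : EuclideanSpace ℂ (Fin k)} {S : Submodule ℂ (EuclideanSpace ℂ (Fin k))}

theorem deriv_mem_of_isGeodesic {c : ℝ → EuclideanSpace ℂ (Fin k)}
    (hc : IsGeodesic (ball k) (metric k) c) (h0 : deriv c 0 ∈ S) (t : ℝ) : deriv c t ∈ S := by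
  obtain ⟨hsm, hgeo⟩ := hc
  have hdsm : ContDiff ℝ ∞ (deriv c) := (contDiff_infty_iff_deriv.1 hsm).2
  have hκ : Continuous fun t => connectionForm (c t) (deriv c t) :=
    continuous_iff_continuousAt.2 fun t =>
      ((contDiffAt_connectionForm (n := 0) (q := (c t, deriv c t))
        (one_sub_norm_sq_pos (hgeo t).1).ne').continuousAt).comp (f := fun t => (c t, deriv c t))
          (hsm.continuous.prodMk hdsm.continuous).continuousAt
  have hderiv (t : ℝ) :
      HasDerivAt (deriv c) ((-2 * connectionForm (c t) (deriv c t)) • deriv c t) t := by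
    refine (hdsm.differentiable (by simp) t).hasDerivAt.congr_deriv ?_
    have hcov := (hgeo t).2
    rw [covAlong_metric (hgeo t).1] at hcov
    rw [eq_neg_of_add_eq_zero_left hcov]
    module
  rw [eq_exp_integral_smul_of_hasDerivAt (continuous_const.mul hκ) hderiv t]
  exact S.smul_mem _ h0

/-- The intersection of the ball with the complex affine subspace through `a` of direction `S`:
the ball model picture of a totally geodesic complex submanifold, see `expImage_submodule`. -/
def slice (a : EuclideanSpace ℂ (Fin k)) (S : Submodule ℂ (EuclideanSpace ℂ (Fin k))) :
    Set (EuclideanSpace ℂ (Fin k)) :=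
  {q | q ∈ ball k ∧ q - a ∈ S}

theorem slice_eq_of_mem (hp : p ∈ slice a S) : slice a S = slice p S := by
  ext q
  refine and_congr_right fun _ => ?_
  rw [← sub_add_sub_cancel q p a]
  exact S.add_mem_iff_left hp.2

theorem expImage_submodule (hb : b ∈ ball k) (S : Submodule ℂ (EuclideanSpace ℂ (Fin k))) :
    expImage (ball k) (metric k) b S = slice b S := by
  ext q
  constructor
  · rintro ⟨c, hc, rfl, h0, rfl⟩
    exact ⟨(hc.2 1).1, sub_mem_of_forall_deriv_mem
      (S.restrictScalars ℝ).closed_of_finiteDimensional (hc.1.differentiable (by simp))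
      (deriv_mem_of_isGeodesic hc h0) 1 0⟩
  · rintro ⟨hq, hqS⟩
    obtain ⟨c, hc, rfl, rfl, hspan⟩ := exists_isGeodesic hb hq
    refine ⟨c, hc, rfl, ?_, rfl⟩
    have h0 := mem_of_eventually_sub_mem (S := (Submodule.span ℂ {c 1 - c 0}).restrictScalars ℝ)
      (Submodule.closed_of_finiteDimensional _)
      ((hc.1.differentiable (by simp)) 0).hasDerivAt (Eventually.of_forall hspan)
    exact (Submodule.span_singleton_le_iff_mem _ S).2 hqS h0

theorem tangentDirs_slice (ha : a ∈ ball k) (S : Submodule ℂ (EuclideanSpace ℂ (Fin k))) :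
    tangentDirs (slice a S) a = S := by
  ext x
  constructor
  · rintro ⟨c, hc, hE, -, rfl⟩
    exact mem_of_eventually_sub_mem (S.restrictScalars ℝ).closed_of_finiteDimensional
      (hc.differentiableAt (by simp)).hasDerivAt (hE.mono fun t ht => ht.2)
  · intro hx
    have hline := hasDerivAt_line a x
    refine ⟨fun t => a + t • x, ?_, ?_, by simp, hline.deriv⟩
    · exact (contDiff_const.add (contDiff_id.smul contDiff_const)).contDiffAt
    · have hball : ball k ∈ 𝓝 (a + (0 : ℝ) • x) := by
        rw [zero_smul, add_zero]
        exact Metric.isOpen_ball.mem_nhds ha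
      filter_upwards [hline.continuousAt.preimage_mem_nhds hball] with t ht
      refine ⟨ht, ?_⟩
      rw [add_sub_cancel_left]
      exact (S.restrictScalars ℝ).smul_mem t hx

theorem mem_normalSpace_slice (ha : a ∈ ball k) :
    z ∈ normalSpace (metric k) (slice a S) a ↔ ∀ x ∈ S, hermitianMetric a x z = 0 := by
  rw [normalSpace, tangentDirs_slice ha]
  simp only [metric_eq_re_hermitianMetric, mem_ofPred_eq, SetLike.mem_coe]
  refine ⟨fun h x hx => Complex.ext (h x hx) ?_, fun h x hx => by rw [h x hx, Complex.zero_re]⟩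
  have hI := h _ (S.smul_mem Complex.I hx)
  rw [hermitianMetric_smul_left] at hI
  simpa using hI

theorem smul_mem_normalSpace_slice (ha : a ∈ ball k) (l : ℂ)
    (hz : z ∈ normalSpace (metric k) (slice a S) a) :
    l • z ∈ normalSpace (metric k) (slice a S) a := by
  rw [mem_normalSpace_slice ha] at hz ⊢
  intro x hx
  rw [hermitianMetric_smul_right, hz x hx, mul_zero]

end Slices

section ComplexPlanes

variable {k : ℕ} {b u v : EuclideanSpace ℂ (Fin k)}

theorem eq_hermitianMetric_smul_of_curvature_eq (hb : b ∈ ball k) (hu : metric k b u u = 1)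
    (huv : metric k b u v = 0) (hR : curvature (metric k) b v u u = (-4 : ℝ) • v) :
    v = hermitianMetric b u v • u := by
  have hskew : hermitianMetric b v u = -hermitianMetric b u v := by
    rw [metric_eq_re_hermitianMetric] at huv
    rw [← star_hermitianMetric b u v, Complex.star_def]
    exact Complex.ext (by simp [huv]) (by simp)
  rw [curvature_metric hb, hermitianMetric_self, hu, hskew, ← Complex.coe_smul] at hR
  have h3 : (3 : ℂ) • v = (3 : ℂ) • hermitianMetric b u v • u := by
    push_cast at hR
    linear_combination (norm := module) hR
  exact smul_right_injective _ three_ne_zero h3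

theorem IsComplexPlane.exists_eq_expImage_span {E : Set (EuclideanSpace ℂ (Fin k))}
    (hE : IsComplexPlane k E) : ∃ b ∈ ball k, ∃ u : EuclideanSpace ℂ (Fin k), u ≠ 0 ∧
      E = expImage (ball k) (metric k) b (Submodule.span ℂ {u}) := by
  obtain ⟨b, hb, u, v, hu, hv, huv, hR, rfl⟩ := hE
  have hu0 : u ≠ 0 := by
    rintro rfl
    simp at hu
  have hvu := eq_hermitianMetric_smul_of_curvature_eq hb hu huv hR
  have him : (hermitianMetric b u v).im ≠ 0 := fun him => by
    rw [metric_eq_re_hermitianMetric] at huv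
    have h0 : hermitianMetric b u v = 0 := Complex.ext huv him
    rw [h0, zero_smul] at hvu
    rw [hvu] at hv
    simp at hv
  refine ⟨b, hb, u, hu0, ?_⟩
  rw [hvu, coe_span_real_pair_smul u him]

theorem IsComplexPlane.exists_tangentDirs_eq {L : Set (EuclideanSpace ℂ (Fin k))}
    {a : EuclideanSpace ℂ (Fin k)} (hL : IsComplexPlane k L) (ha : a ∈ L) :
    ∃ T : Submodule ℂ (EuclideanSpace ℂ (Fin k)), tangentDirs L a = T := by
  obtain ⟨b, hb, u, -, rfl⟩ := hL.exists_eq_expImage_span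
  rw [expImage_submodule hb] at ha ⊢
  rw [slice_eq_of_mem ha, tangentDirs_slice ha.1]
  exact ⟨_, rfl⟩

end ComplexPlanes

end ComplexHyperbolic

namespace ChartGeometry

section LineIntegrals

variable {V F : Type*} [NormedAddCommGroup V] [NormedSpace ℝ V] [NormedAddCommGroup F]
  {E : Set V} {a : V} {c : ℝ → V} {φ : V × V → F}

theorem IsPiecewiseSmoothLoop.intervalIntegrable (hc : IsPiecewiseSmoothLoop E a c)
    (hφ : ContinuousOn φ (E ×ˢ univ)) :
    IntervalIntegrable (fun t => φ (c t, deriv c t)) MeasureTheory.volume 0 1 := by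
  obtain ⟨-, hE, -, -, n, τ, hmono, hτ0, hτn, hsmooth⟩ := hc
  rw [← hτ0, ← hτn]
  refine IntervalIntegrable.trans_iterate fun i hi => ?_
  rcases (hmono i.le_succ).eq_or_lt with heq | hlt
  · rw [Nat.succ_eq_add_one] at heq
    rw [heq]
  have hmaps : MapsTo (fun t => (c t, derivWithin c (Icc (τ i) (τ (i + 1))) t))
      (Icc (τ i) (τ (i + 1))) (E ×ˢ univ) := fun t ht =>
    ⟨hE t ⟨hτ0 ▸ (hmono (Nat.zero_le i)).trans ht.1, hτn ▸ ht.2.trans (hmono hi)⟩, mem_univ _⟩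
  have hcont := hφ.comp ((hsmooth i hi).continuousOn.prodMk
    ((hsmooth i hi).continuousOn_derivWithin (uniqueDiffOn_Icc hlt) (by simp))) hmaps
  rw [← uIcc_of_le hlt.le] at hcont
  refine hcont.intervalIntegrable.congr_uIoo fun t ht => ?_
  rw [uIoo_of_le hlt.le] at ht
  simp only [Function.comp_apply, uIcc_of_le hlt.le,
    derivWithin_of_mem_nhds (Icc_mem_nhds ht.1 ht.2)]

theorem IsPiecewiseSmoothLoop.exists_finset_hasDerivAt_integral [NormedSpace ℝ F]
    [CompleteSpace F] (hc : IsPiecewiseSmoothLoop E a c) (hφ : ContinuousOn φ (E ×ˢ univ)) :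
    ∃ H : Finset ℝ, ∀ t ∈ Ioo (0 : ℝ) 1, t ∉ H → DifferentiableAt ℝ c t ∧
      HasDerivAt (fun t => ∫ s in (0 : ℝ)..t, φ (c s, deriv c s)) (φ (c t, deriv c t)) t := by
  obtain ⟨H, hH⟩ := hc.exists_finset_contDiffAt
  have hcont : ∀ s ∈ Ioo (0 : ℝ) 1 \ H, ContinuousAt (fun t => φ (c t, deriv c t)) s := by
    rintro s ⟨hs, hsH⟩
    have hderiv : ContinuousAt (deriv c) s := by
      simpa using ((hH s hs hsH).continuousAt_fderiv (by simp)).clm_apply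
        (continuousAt_const (y := (1 : ℝ)))
    have hcE : ∀ᶠ t in 𝓝 s, (c t, deriv c t) ∈ E ×ˢ univ := by
      filter_upwards [isOpen_Ioo.mem_nhds hs] with t ht
      exact ⟨hc.2.1 t (Ioo_subset_Icc_self ht), mem_univ _⟩
    exact (hφ _ hcE.self_of_nhds).tendsto.comp (tendsto_nhdsWithin_iff.2
      ⟨(hH s hs hsH).continuousAt.prodMk hderiv, hcE⟩)
  refine ⟨H, fun t ht htH => ⟨(hH t ht htH).differentiableAt (by simp), ?_⟩⟩
  refine intervalIntegral.integral_hasDerivAt_right ((hc.intervalIntegrable hφ).mono_set ?_)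
    (ContinuousAt.stronglyMeasurableAtFilter (isOpen_Ioo.sdiff H.finite_toSet.isClosed) hcont t
      ⟨ht, htH⟩) (hcont t ⟨ht, htH⟩)
  rw [uIcc_of_le ht.1.le, uIcc_of_le zero_le_one]
  exact Icc_subset_Icc_right ht.2.le

end LineIntegrals

end ChartGeometry

namespace ComplexHyperbolic

open ChartGeometry

section Holonomy

variable {k : ℕ} {a p z w : EuclideanSpace ℂ (Fin k)}
  {S : Submodule ℂ (EuclideanSpace ℂ (Fin k))} {c : ℝ → EuclideanSpace ℂ (Fin k)}

/-- The complex number by which parallel translation along a loop `c : [0, 1] → ball k` in a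
totally geodesic complex submanifold multiplies normal vectors, see `parallelTranslate_iff`. -/
noncomputable def holonomyFactor (c : ℝ → EuclideanSpace ℂ (Fin k)) : ℂ :=
  Complex.exp (-∫ t in (0 : ℝ)..1, connectionForm (c t) (deriv c t))

theorem holonomyFactor_ne_zero (c : ℝ → EuclideanSpace ℂ (Fin k)) : holonomyFactor c ≠ 0 :=
  Complex.exp_ne_zero _

theorem continuousOn_connectionForm_slice (a : EuclideanSpace ℂ (Fin k))
    (S : Submodule ℂ (EuclideanSpace ℂ (Fin k))) :
    ContinuousOn (fun q : EuclideanSpace ℂ (Fin k) × EuclideanSpace ℂ (Fin k) =>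
      connectionForm q.1 q.2) (slice a S ×ˢ univ) := fun _ hq =>
  (contDiffAt_connectionForm (n := 0) (one_sub_norm_sq_pos hq.1.1).ne').continuousAt
    |>.continuousWithinAt

theorem connectionForm_sub_smul_sub (ha : a ∈ ball k) (hp : p ∈ slice a S)
    (hz : ∀ x ∈ S, hermitianMetric a x z = 0) :
    connectionForm p (z - connectionForm a z • (p - a)) = connectionForm a z := by
  have haden : 1 - inner ℂ a a ≠ 0 := by
    rw [← ofReal_one_sub_norm_sq]
    exact Complex.ofReal_ne_zero.2 (one_sub_norm_sq_pos ha).ne'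
  have hpden : 1 - inner ℂ p p ≠ 0 := by
    rw [← ofReal_one_sub_norm_sq]
    exact Complex.ofReal_ne_zero.2 (one_sub_norm_sq_pos hp.1).ne'
  have horth := hz _ hp.2
  simp only [hermitianMetric, connectionForm, ofReal_one_sub_norm_sq, star_div₀, inner_sub_left,
    inner_sub_right, inner_smul_right, Complex.star_def, map_sub, map_one, inner_conj_symm]
    at horth ⊢
  field_simp at horth ⊢
  linear_combination horth

theorem parallelTranslate_normal (ha : a ∈ ball k) (hc : IsPiecewiseSmoothLoop (slice a S) a c)
    (hz : z ∈ normalSpace (metric k) (slice a S) a) :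
    ParallelTranslate (metric k) c z (holonomyFactor c • z) := by
  rw [mem_normalSpace_slice ha] at hz
  have hφ := continuousOn_connectionForm_slice a S
  obtain ⟨H, hH⟩ := hc.exists_finset_hasDerivAt_integral hφ
  have hprim := intervalIntegral.continuousOn_primitive_interval' (hc.intervalIntegrable hφ)
    left_mem_uIcc
  rw [uIcc_of_le zero_le_one] at hprim
  obtain ⟨hcc, hcS, hc0, hc1, -⟩ := hc
  -- up to the scalar factor, this is the normal part of a fixed vector of `ℂ^{k,1}`
  refine ⟨fun t => Complex.exp (-∫ s in (0 : ℝ)..t, connectionForm (c s) (deriv c s)) •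
    (z - connectionForm a z • (c t - a)), ⟨?_, H, fun t ht htH => ?_⟩, ?_, ?_⟩
  · exact hprim.neg.cexp.smul
      (continuousOn_const.sub ((hcc.sub continuousOn_const).const_smul (connectionForm a z)))
  · obtain ⟨hcd, hint⟩ := hH t ht htH
    have hderiv := hint.fun_neg.cexp.fun_smul
      (((hcd.hasDerivAt.sub_const a).fun_const_smul (connectionForm a z)).const_sub z)
    have htS := hcS t (Ioo_subset_Icc_self ht)
    refine ⟨hderiv.differentiableAt, ?_⟩
    rw [covAlong_metric htS.1, hderiv.deriv, connectionForm_smul,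
      connectionForm_sub_smul_sub ha htS hz]
    module
  · simp [hc0]
  · simp [hc1, holonomyFactor]

theorem parallelTranslate_iff (ha : a ∈ ball k) (hc : IsPiecewiseSmoothLoop (slice a S) a c)
    (hz : z ∈ normalSpace (metric k) (slice a S) a) :
    ParallelTranslate (metric k) c z w ↔ w = holonomyFactor c • z := by
  have hpar := parallelTranslate_normal ha hc hz
  refine ⟨fun h => ParallelTranslate.unique (fun p hp => differentiableAt_metric hp.1)
    (fun p hp => metric_isInvertible k p hp.1) metric_symm (fun u => metric_pos k a u ha) hc
    h hpar, ?_⟩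
  rintro rfl
  exact hpar

theorem parallelTranslate_image_eq (ha : a ∈ ball k)
    (hc : IsPiecewiseSmoothLoop (slice a S) a c)
    (T : Submodule ℂ (EuclideanSpace ℂ (Fin k))) :
    {w | ∃ z ∈ (T : Set (EuclideanSpace ℂ (Fin k))) ∩
        unitNormalSphere (metric k) (slice a S) a, ParallelTranslate (metric k) c z w} =
      (T : Set (EuclideanSpace ℂ (Fin k))) ∩ unitNormalSphere (metric k) (slice a S) a := by
  have hisom {z w : EuclideanSpace ℂ (Fin k)} (h : ParallelTranslate (metric k) c z w) :
      metric k a w w = metric k a z z :=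
    h.metric_apply_self (fun p hp => differentiableAt_metric hp.1)
      (fun p hp => metric_isInvertible k p hp.1) metric_symm hc
  ext w
  constructor
  · rintro ⟨z, ⟨hzT, hzN, hz1⟩, hpar⟩
    obtain rfl := (parallelTranslate_iff ha hc hzN).1 hpar
    exact ⟨T.smul_mem _ hzT, smul_mem_normalSpace_slice ha _ hzN, (hisom hpar).trans hz1⟩
  · rintro ⟨hwT, hwN, hw1⟩
    have hzN := smul_mem_normalSpace_slice ha (holonomyFactor c)⁻¹ hwN
    have hpar : ParallelTranslate (metric k) c ((holonomyFactor c)⁻¹ • w) w :=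
      (parallelTranslate_iff ha hc hzN).2 (smul_inv_smul₀ (holonomyFactor_ne_zero c) w).symm
    exact ⟨_, ⟨T.smul_mem _ hwT, hzN, (hisom hpar).symm.trans hw1⟩, hpar⟩

end Holonomy

end ComplexHyperbolic

namespace ChartGeometry

theorem isPiecewiseSmoothLoop_of_contDiff {V : Type*} [NormedAddCommGroup V] [NormedSpace ℝ V]
    {E : Set V} {a : V} {c : ℝ → V} (hc : ContDiff ℝ ∞ c) (hE : ∀ t ∈ Icc (0 : ℝ) 1, c t ∈ E)
    (h0 : c 0 = a) (h1 : c 1 = a) : IsPiecewiseSmoothLoop E a c :=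
  ⟨hc.continuous.continuousOn, hE, h0, h1, 1, fun i => i, Nat.mono_cast, Nat.cast_zero,
    Nat.cast_one, fun _ _ => hc.contDiffOn⟩

end ChartGeometry

namespace ComplexHyperbolic

open ChartGeometry

theorem exp_neg_integral_ne_one {f : ℝ → ℂ} (hf : IntervalIntegrable f MeasureTheory.volume 0 1)
    (him : ∀ t ∈ Ioo (0 : ℝ) 1, (f t).im ∈ Ioo 0 (2 * Real.pi)) :
    Complex.exp (-∫ t in (0 : ℝ)..1, f t) ≠ 1 := by
  have hfim : IntervalIntegrable (fun t => (f t).im) MeasureTheory.volume 0 1 :=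
    ⟨hf.1.im, hf.2.im⟩
  have hcomm : ∫ t in (0 : ℝ)..1, (f t).im = (∫ t in (0 : ℝ)..1, f t).im :=
    Complex.imCLM.intervalIntegral_comp_comm hf
  have hpos : 0 < (∫ t in (0 : ℝ)..1, f t).im := by
    rw [← hcomm]
    exact intervalIntegral.intervalIntegral_pos_of_pos_on hfim (fun t ht => (him t ht).1)
      zero_lt_one
  have hlt : (∫ t in (0 : ℝ)..1, f t).im < 2 * Real.pi := by
    have hgap := intervalIntegral.intervalIntegral_pos_of_pos_on
      (intervalIntegrable_const.sub hfim) (fun t ht => sub_pos.2 (him t ht).2) zero_lt_one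
    rw [intervalIntegral.integral_sub intervalIntegrable_const hfim, hcomm] at hgap
    simpa using hgap
  intro hexp
  obtain ⟨n, hn⟩ := Complex.exp_eq_one_iff.1 hexp
  have hn_im : -(∫ t in (0 : ℝ)..1, f t).im = n * (2 * Real.pi) := by
    simpa using congrArg Complex.im hn
  have hn_neg : (n : ℝ) < 0 := by nlinarith [Real.pi_pos]
  have hn_gt : (-1 : ℝ) < n := by nlinarith [Real.pi_pos]
  norm_cast at hn_neg hn_gt
  lia

section CircleLoop

variable {V : Type*} [NormedAddCommGroup V] [InnerProductSpace ℂ V] {a e : V}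

/-- The circle through `a` with center `a - e` in the complex line through `a` of direction `e`,
traversed once for `t ∈ [0, 1]`. -/
noncomputable def circleLoop (a e : V) (t : ℝ) : V :=
  a + circleMap (-1) 1 (2 * Real.pi * t) • e

theorem circleLoop_zero (a e : V) : circleLoop a e 0 = a := by
  simp [circleLoop, circleMap]

theorem circleLoop_one (a e : V) : circleLoop a e 1 = a := by
  simp [circleLoop, circleMap, Complex.exp_two_pi_mul_I]

theorem circleLoop_sub_mem {S : Submodule ℂ V} (he : e ∈ S) (t : ℝ) : circleLoop a e t - a ∈ S := by
  rw [circleLoop, add_sub_cancel_left]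
  exact S.smul_mem _ he

theorem norm_circleMap_neg_one_one_sq (θ : ℝ) :
    ‖circleMap (-1) 1 θ‖ ^ 2 = 2 * (1 - Real.cos θ) := by
  rw [← Complex.normSq_eq_norm_sq, Complex.normSq_apply, circleMap]
  simp only [Complex.add_re, Complex.add_im, Complex.neg_re, Complex.neg_im, Complex.one_re,
    Complex.one_im, Complex.ofReal_one, one_mul, Complex.exp_ofReal_mul_I_re,
    Complex.exp_ofReal_mul_I_im]
  linear_combination Real.sin_sq_add_cos_sq θ

theorem norm_circleLoop_sub_sq (a e : V) (t : ℝ) :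
    ‖circleLoop a e t - a‖ ^ 2 = 2 * ‖e‖ ^ 2 * (1 - Real.cos (2 * Real.pi * t)) := by
  rw [circleLoop, add_sub_cancel_left, norm_smul, mul_pow, norm_circleMap_neg_one_one_sq]
  ring

theorem norm_circleLoop_sub_le (a e : V) (t : ℝ) : ‖circleLoop a e t - a‖ ≤ 2 * ‖e‖ := by
  refine le_of_sq_le_sq ?_ (by positivity)
  rw [norm_circleLoop_sub_sq]
  nlinarith [Real.neg_one_le_cos (2 * Real.pi * t), sq_nonneg ‖e‖]

theorem one_sub_norm_circleLoop_sq (hae : inner ℂ a e = 0) (t : ℝ) :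
    1 - ‖circleLoop a e t‖ ^ 2 =
      1 - ‖a‖ ^ 2 - 2 * ‖e‖ ^ 2 * (1 - Real.cos (2 * Real.pi * t)) := by
  have horth : inner ℂ a (circleLoop a e t - a) = 0 := by
    rw [circleLoop, add_sub_cancel_left, inner_smul_right, hae, mul_zero]
  have hpyth := norm_add_sq_eq_norm_sq_add_norm_sq_of_inner_eq_zero (𝕜 := ℂ) a _ horth
  rw [add_sub_cancel] at hpyth
  linarith [norm_circleLoop_sub_sq a e t]

variable [NormedSpace ℝ V] [IsScalarTower ℝ ℂ V]

theorem contDiff_circleLoop (a e : V) : ContDiff ℝ ∞ (circleLoop a e) :=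
  contDiff_const.add (((contDiff_circleMap (-1) 1).comp
    (contDiff_const.mul contDiff_id)).smul contDiff_const)

theorem deriv_circleLoop (a e : V) (t : ℝ) :
    deriv (circleLoop a e) t =
      ((2 * Real.pi : ℝ) * (circleMap 0 1 (2 * Real.pi * t) * Complex.I)) • e := by
  have hangle : HasDerivAt (fun t : ℝ => 2 * Real.pi * t) (2 * Real.pi) t := by
    simpa using (hasDerivAt_id t).const_mul (2 * Real.pi)
  have hcircle := (hasDerivAt_circleMap (-1) 1 (2 * Real.pi * t)).scomp t hangle
  rw [Complex.real_smul] at hcircle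
  exact ((hcircle.smul_const e).const_add a).deriv

theorem im_connectionForm_circleLoop (hae : inner ℂ a e = 0) (t : ℝ) :
    (connectionForm (circleLoop a e t) (deriv (circleLoop a e) t)).im =
      2 * Real.pi * (‖e‖ ^ 2 * (1 - Real.cos (2 * Real.pi * t)) /
        (1 - ‖a‖ ^ 2 - 2 * ‖e‖ ^ 2 * (1 - Real.cos (2 * Real.pi * t)))) := by
  have hee : inner ℂ e e = ((‖e‖ ^ 2 : ℝ) : ℂ) := by
    rw [inner_self_eq_norm_sq_to_K]
    simp
  rw [connectionForm, Complex.div_ofReal_im, one_sub_norm_circleLoop_sq hae, deriv_circleLoop,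
    ← mul_div_assoc]
  congr 1
  rw [circleLoop, inner_smul_right, inner_add_left, inner_smul_left, hae, hee, zero_add, circleMap,
    circleMap]
  simp only [map_add, map_neg, map_one, map_mul, Complex.conj_ofReal, Complex.mul_im,
    Complex.mul_re, Complex.add_im, Complex.add_re, Complex.neg_re, Complex.neg_im,
    Complex.conj_re, Complex.conj_im, Complex.exp_ofReal_mul_I_re, Complex.exp_ofReal_mul_I_im,
    Complex.ofReal_re, Complex.ofReal_im, Complex.I_re, Complex.I_im, Complex.one_re,
    Complex.one_im, Complex.zero_re, Complex.zero_im]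
  linear_combination (2 * Real.pi * ‖e‖ ^ 2) * Real.sin_sq_add_cos_sq (2 * Real.pi * t)

theorem im_connectionForm_circleLoop_mem_Ioo (hae : inner ℂ a e = 0) (he : e ≠ 0)
    (hsmall : 6 * ‖e‖ ^ 2 < 1 - ‖a‖ ^ 2) {t : ℝ} (ht : t ∈ Ioo (0 : ℝ) 1) :
    (connectionForm (circleLoop a e t) (deriv (circleLoop a e) t)).im ∈ Ioo 0 (2 * Real.pi) := by
  have hpi := Real.pi_pos
  have he2 : 0 < ‖e‖ ^ 2 := pow_pos (norm_pos_iff.2 he) 2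
  have hcos : 0 < 1 - Real.cos (2 * Real.pi * t) := by
    refine sub_pos.2 ((Real.cos_le_one _).lt_of_ne fun h => ?_)
    rw [Real.cos_eq_one_iff_of_lt_of_lt (by nlinarith [ht.1]) (by nlinarith [ht.2])] at h
    exact (mul_pos (by positivity) ht.1).ne' h
  have hcos2 : 1 - Real.cos (2 * Real.pi * t) ≤ 2 := by
    linarith [Real.neg_one_le_cos (2 * Real.pi * t)]
  have hden : 0 < 1 - ‖a‖ ^ 2 - 2 * ‖e‖ ^ 2 * (1 - Real.cos (2 * Real.pi * t)) := by nlinarith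
  rw [im_connectionForm_circleLoop hae]
  refine ⟨by positivity, mul_lt_of_lt_one_right (by positivity) ((div_lt_one hden).2 ?_)⟩
  nlinarith

end CircleLoop

section Nonflatness

variable {k : ℕ} {a b z : EuclideanSpace ℂ (Fin k)}
  {S : Submodule ℂ (EuclideanSpace ℂ (Fin k))}

theorem circleLoop_mem_slice {e : EuclideanSpace ℂ (Fin k)} (he : e ∈ S) (hae : inner ℂ a e = 0)
    (hsmall : 4 * ‖e‖ ^ 2 < 1 - ‖a‖ ^ 2) (t : ℝ) : circleLoop a e t ∈ slice a S := by
  refine ⟨mem_ball_zero_iff.2 ?_, circleLoop_sub_mem he t⟩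
  have hnorm := one_sub_norm_circleLoop_sq hae t
  nlinarith [Real.neg_one_le_cos (2 * Real.pi * t), sq_nonneg ‖e‖,
    norm_nonneg (circleLoop a e t)]

theorem exists_loop_holonomyFactor_ne_one (ha : a ∈ ball k) (haS : a ∈ Sᗮ) (hS : S ≠ ⊥)
    {N : Set (EuclideanSpace ℂ (Fin k))} (hN : N ∈ 𝓝 a) :
    ∃ c, IsPiecewiseSmoothLoop (slice a S ∩ N) a c ∧ holonomyFactor c ≠ 1 := by
  obtain ⟨δ, hδ, hNδ⟩ := Metric.mem_nhds_iff.1 hN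
  obtain ⟨e, heS, he0, heδ, he6⟩ :
      ∃ e ∈ S, e ≠ 0 ∧ 2 * ‖e‖ < δ ∧ 6 * ‖e‖ ^ 2 < 1 - ‖a‖ ^ 2 := by
    obtain ⟨u, hu, hu0⟩ := S.exists_mem_ne_zero_of_ne_bot hS
    have hsmall : ∀ᶠ r : ℂ in 𝓝[≠] 0, 2 * ‖r • u‖ < δ ∧ 6 * ‖r • u‖ ^ 2 < 1 - ‖a‖ ^ 2 := by
      have htendsto : Tendsto (fun r : ℂ => 2 * ‖r • u‖) (𝓝 0) (𝓝 0) :=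
        Continuous.tendsto' (by fun_prop) 0 0 (by simp)
      have htendsto_sq : Tendsto (fun r : ℂ => 6 * ‖r • u‖ ^ 2) (𝓝 0) (𝓝 0) :=
        Continuous.tendsto' (by fun_prop) 0 0 (by simp)
      exact nhdsWithin_le_nhds ((htendsto.eventually_lt_const hδ).and
        (htendsto_sq.eventually_lt_const (one_sub_norm_sq_pos ha)))
    obtain ⟨r, hr, hr0⟩ := (hsmall.and self_mem_nhdsWithin).exists
    exact ⟨r • u, S.smul_mem r hu, smul_ne_zero hr0 hu0, hr⟩
  have hae : inner ℂ a e = 0 := Submodule.inner_left_of_mem_orthogonal heS haS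
  have hslice := circleLoop_mem_slice heS hae (by nlinarith [sq_nonneg ‖e‖])
  have hloop {E : Set (EuclideanSpace ℂ (Fin k))} (hE : ∀ t, circleLoop a e t ∈ E) :
      IsPiecewiseSmoothLoop E a (circleLoop a e) :=
    isPiecewiseSmoothLoop_of_contDiff (contDiff_circleLoop a e) (fun t _ => hE t)
      (circleLoop_zero a e) (circleLoop_one a e)
  refine ⟨circleLoop a e, hloop fun t => ⟨hslice t, hNδ ?_⟩, ?_⟩
  · exact mem_ball_iff_norm.2 ((norm_circleLoop_sub_le a e t).trans_lt heδ)
  · exact exp_neg_integral_ne_one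
      ((hloop hslice).intervalIntegrable (continuousOn_connectionForm_slice a S))
      fun t ht => im_connectionForm_circleLoop_mem_Ioo hae he0 he6 ht

theorem exists_mem_slice_mem_orthogonal (hb : b ∈ ball k)
    (S : Submodule ℂ (EuclideanSpace ℂ (Fin k))) : ∃ a ∈ slice b S, a ∈ Sᗮ := by
  refine ⟨Sᗮ.starProjection b, ⟨mem_ball_zero_iff.2 ?_, ?_⟩, Sᗮ.starProjection_apply_mem b⟩
  · exact (Submodule.norm_starProjection_apply_le _ b).trans_lt (mem_ball_zero_iff.1 hb)
  · have hproj := Submodule.sub_starProjection_mem_orthogonal (K := Sᗮ) b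
    rw [S.orthogonal_orthogonal] at hproj
    rw [← neg_sub]
    exact S.neg_mem hproj

theorem mem_normalSpace_slice_of_mem_orthogonal (ha : a ∈ ball k) (haS : a ∈ Sᗮ) (hz : z ∈ Sᗮ) :
    z ∈ normalSpace (metric k) (slice a S) a := by
  rw [mem_normalSpace_slice ha]
  intro x hx
  rw [hermitianMetric, connectionForm, Submodule.inner_right_of_mem_orthogonal hx hz,
    Submodule.inner_left_of_mem_orthogonal hx haS]
  simp

theorem not_isFlatNormalBundle_slice (hb : b ∈ ball k) (hbot : S ≠ ⊥) (htop : S ≠ ⊤) :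
    ¬ IsFlatNormalBundle (metric k) (slice b S) := by
  obtain ⟨a, hab, haS⟩ := exists_mem_slice_mem_orthogonal hb S
  obtain ⟨z, hzS, hz0⟩ := Sᗮ.exists_mem_ne_zero_of_ne_bot (mt S.orthogonal_eq_bot_iff.1 htop)
  have hz := mem_normalSpace_slice_of_mem_orthogonal hab.1 haS hzS
  rw [slice_eq_of_mem hab]
  intro hflat
  obtain ⟨N, hN, htrivial⟩ := hflat a ⟨hab.1, by simp⟩
  obtain ⟨c, hc, hne⟩ := exists_loop_holonomyFactor_ne_one hab.1 haS hbot hN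
  have hfix := (parallelTranslate_iff hab.1 (hc.mono inter_subset_left) hz).1 (htrivial c hc z hz)
  exact hne (smul_left_injective ℂ hz0 (by simpa using hfix.symm))

end Nonflatness

theorem curvature_J_of_hermitianMetric_eq_zero {k : ℕ} {a x z : EuclideanSpace ℂ (Fin k)}
    (ha : a ∈ ball k) (hx : metric k a x x = 1) (hxz : hermitianMetric a x z = 0) :
    curvature (metric k) a x (J x) z = (2 : ℝ) • J z := by
  rw [curvature_metric ha, J, J, hermitianMetric_smul_left, hermitianMetric_smul_left,
    hermitianMetric_smul_right, hermitianMetric_self, hx, hxz, Complex.star_def, Complex.conj_I,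
    ← Complex.coe_smul]
  push_cast
  module

theorem span_singleton_ne_top {k : ℕ} (hk : 2 ≤ k) (u : EuclideanSpace ℂ (Fin k)) :
    Submodule.span ℂ {u} ≠ ⊤ := by
  intro htop
  have hrank := finrank_span_le_card (R := ℂ) ({u} : Set (EuclideanSpace ℂ (Fin k)))
  rw [htop, finrank_top, finrank_euclideanSpace_fin] at hrank
  simp only [Set.toFinset_singleton, Finset.card_singleton] at hrank
  lia

end ComplexHyperbolic

open ChartGeometry ComplexHyperbolic in
theorem mainTheorem12_general {k : ℕ} {b : EuclideanSpace ℂ (Fin k)} (hb : b ∈ ball k)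
    (S : Submodule ℂ (EuclideanSpace ℂ (Fin k))) {E : Set (EuclideanSpace ℂ (Fin k))}
    (hE : E = expImage (ball k) (metric k) b S) :
    (∀ a ∈ E, ∀ c : ℝ → EuclideanSpace ℂ (Fin k), IsPiecewiseSmoothLoop E a c →
      (∀ z ∈ normalSpace (metric k) E a, ∃ w ∈ normalSpace (metric k) E a,
        ∀ w', ParallelTranslate (metric k) c z w' ↔ w' = w) ∧
      ∀ C : Set (EuclideanSpace ℂ (Fin k)), IsFiber k E a C →
        {w | ∃ z ∈ C, ParallelTranslate (metric k) c z w} = C) ∧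
    (S ≠ ⊥ → S ≠ ⊤ → ¬ IsFlatNormalBundle (metric k) E) ∧
    (∀ a ∈ E, ∀ x ∈ tangentDirs E a, metric k a x x = 1 → ∀ z ∈ normalSpace (metric k) E a,
      curvature (metric k) a x (J x) z = (2 : ℝ) • J z) := by
  rw [expImage_submodule hb] at hE
  subst hE
  refine ⟨fun a ha c hc => ?_, not_isFlatNormalBundle_slice hb, fun a ha x hx hx1 z hz => ?_⟩
  · rw [slice_eq_of_mem ha] at hc ⊢
    refine ⟨fun z hz => ⟨_, smul_mem_normalSpace_slice ha.1 _ hz,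
      fun w' => parallelTranslate_iff ha.1 hc hz⟩, ?_⟩
    rintro C ⟨L, hL, haL, -, rfl⟩
    obtain ⟨T, hT⟩ := hL.exists_tangentDirs_eq haL
    rw [hT]
    exact parallelTranslate_image_eq ha.1 hc T
  · rw [slice_eq_of_mem ha] at hx hz
    rw [tangentDirs_slice ha.1] at hx
    exact curvature_J_of_hermitianMetric_eq_zero ha.1 hx1 ((mem_normalSpace_slice ha.1).1 hz x hx)

theorem mainTheorem12 (k : ℕ) (hk : 1 ≤ k) (E : Set (EuclideanSpace ℂ (Fin k)))
    (hE : ComplexHyperbolic.IsComplexPlane k E) :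
    (∀ a ∈ E, ∀ c : ℝ → EuclideanSpace ℂ (Fin k),
      ChartGeometry.IsPiecewiseSmoothLoop E a c →
        (∀ z ∈ ChartGeometry.normalSpace (ComplexHyperbolic.metric k) E a,
          ∃ w ∈ ChartGeometry.normalSpace (ComplexHyperbolic.metric k) E a,
            ∀ w', ChartGeometry.ParallelTranslate (ComplexHyperbolic.metric k) c z w' ↔ w' = w) ∧
        ∀ C : Set (EuclideanSpace ℂ (Fin k)), ComplexHyperbolic.IsFiber k E a C →
          {w | ∃ z ∈ C, ChartGeometry.ParallelTranslate (ComplexHyperbolic.metric k) c z w} = C) ∧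
    (2 ≤ k → ¬ ChartGeometry.IsFlatNormalBundle (ComplexHyperbolic.metric k) E) ∧
    (∀ a ∈ E, ∀ x ∈ ChartGeometry.tangentDirs E a, ComplexHyperbolic.metric k a x x = 1 →
      ∀ z ∈ ChartGeometry.unitNormalSphere (ComplexHyperbolic.metric k) E a,
        ChartGeometry.curvature (ComplexHyperbolic.metric k) a x (ComplexHyperbolic.J x) z =
          (2 : ℝ) • ComplexHyperbolic.J z) := by
  obtain ⟨b, hb, u, hu, hEu⟩ := hE.exists_eq_expImage_span
  obtain ⟨hholonomy, hflat, hcurv⟩ := mainTheorem12_general hb _ hEu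
  exact ⟨hholonomy,
    fun hk2 => hflat (mt Submodule.span_singleton_eq_bot.1 hu)
      (ComplexHyperbolic.span_singleton_ne_top hk2 u),
    fun a ha x hx hx1 z hz => hcurv a ha x hx hx1 z hz.1⟩
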